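/- Let $\Omega$ be the set of all finite (possibly empty) sequences of natural numbers, ordered by $s\sqsubseteq t$ iff $s$ is an initial segment of $t$. For a downwards-closed $\mathcal T\subseteq\Omega$ let $\partial\mathcal T$ be the set of infinite branches (infinite maximal chains) of $\mathcal T$ and $\overline{\mathcal T}=\mathcal T\cup\partial\mathcal T$, ordered by $\sqsubseteq'$: for $s,t\in\mathcal T$, $s\sqsubseteq' t$ iff $s\sqsubseteq t$; for $s\in\mathcal T$ and $b\in\partial\mathcal T$, $s\sqsubseteq' b$ iff $s\in b$, and never $b\sqsubseteq' s$; for $b,c\in\partial\mathcal T$, $b\sqsubseteq' c$ iff $b=c$. The coarse wedge topology of $\overline{\mathcal T}$ is the topology having as a subbase all sets $\{s : t\sqsubseteq' s\}$ and their complements, where $t\in\overline{\mathcal T}$ is such that the (well-ordered) set of strict predecessors of $t$ has order type $0$ or a successor ordinal. A set $A$ in a Banach space is $\epsilon$-separated if $\|x-y\|>\epsilon$ for all distinct $x,y\in A$. **Theorem.** Let $W$ and $Z$ be Banach spaces over the same field, $\mathbb R$ or $\mathbb C$, with $Z$ separable. Let $R:W\to Z$ be a bounded linear operator, $K\subseteq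 Z^*$ and $\epsilon>0$ be such that $K$ is absolutely convex and weak$^*$-compact and $R^*(K)$ contains an uncountable $\epsilon$-separated subset. Then for any $\delta>0$, any $\theta>0$, any downwards-closed $\mathcal T\subseteq\Omega$, and any bijection $\tau:\mathbb N=\{0,1,2,\dots\}\to\mathcal T$ such that $\tau(l)\sqsubseteq\tau(m)$ implies $l\le m$, there exist families $(w_t)_{t\in\mathcal T}$ of norm-one vectors of $W$ and $(z_t^*)_{t\in\overline{\mathcal T}}\subseteq K$ such that: (i) for all $s\in\mathcal T$ and $t\in\overline{\mathcal T}$: if $s\sqsubseteq' t$, then $\langle z_t^*,Rw_s\rangle=\langle z_s^*,Rw_s\rangle$, and this number is real and $>\frac{\epsilon}{2+\theta}$; if $s\not\sqsubseteq' t$, then $\langle z_t^*,Rw_s\rangle=0$; (ii) the map $t\mapsto z_t^*$ from $\overline{\mathcal T}$ with the coarse wedge topology to $Z^*$ with the weak$^*$ topology is continuous; (iii) $(w_{\tau(m)})_{m=0}^\infty$ is a basic sequence (a Schauder basis of its closed linear span) with basis constant not exceeding $1+\delta$; and (iv) with $Z_0:=\bigcap_{t\in\mathcal T}\ker(z_t^*)$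 and $Q:Z\to Z/Z_0$ the quotient map, $(QRw_{\tau(m)})_{m=0}^\infty$ is a Schauder basis of $Z/Z_0$ with basis constant not exceeding $1+\delta$. Here the basis constant of a Schauder basis is the supremum of the norms of its partial-sum projections. -/

import Mathlib

open scoped ComplexOrder

/-- The coarse wedge topology of a tree: the subbase consists of the wedges `{s | t ≤ s}` and their
complements, over those `t` whose set of strict predecessors has order type `0` (it is empty) or a
successor (it has a greatest element). -/
@[reducible] def coarseWedgeTopology (α : Type*) [PartialOrder α] : TopologicalSpace α :=
  TopologicalSpace.generateFrom
    {U | ∃ t : α, (Set.Iio t = ∅ ∨ ∃ m, IsGreatest (Set.Iio t) m) ∧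
      (U = Set.Ici t ∨ U = (Set.Ici t)ᶜ)}

/-- A set of finite sequences of natural numbers that is closed under initial segments. -/
def IsDownClosed (T : Set (List ℕ)) : Prop :=
  ∀ t ∈ T, ∀ s : List ℕ, s <+: t → s ∈ T

/-- An infinite branch of `T`: an infinite maximal totally ordered subset of `T`, for the order
"is an initial segment of". -/
def IsInfiniteBranch (T b : Set (List ℕ)) : Prop :=
  b.Infinite ∧ Maximal (fun c : Set (List ℕ) => c ⊆ T ∧ IsChain (· <+: ·) c) b

/-- The chain completion of `T`: its nodes together with its infinite branches. -/
inductive TreeBar (T : Set (List ℕ)) : Type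
  | node (t : T) : TreeBar T
  | branch (b : {b : Set (List ℕ) // IsInfiniteBranch T b}) : TreeBar T

namespace TreeBar

/-- The extension to `TreeBar T` of the order "is an initial segment of". -/
def le {T : Set (List ℕ)} : TreeBar T → TreeBar T → Prop
  | node s, node t => (s : List ℕ) <+: (t : List ℕ)
  | node s, branch b => (s : List ℕ) ∈ (b : Set (List ℕ))
  | branch _, node _ => False
  | branch b, branch c => b = c

theorem mem_branch_of_prefix {T b : Set (List ℕ)} (hb : IsInfiniteBranch T b) {s t : List ℕ}
    (hs : s ∈ T) (hst : s <+: t) (ht : t ∈ b) : s ∈ b := by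
  have hc : IsChain (· <+: ·) (insert s b) := by
    refine hb.2.prop.2.insert ?_
    intro c hcb _
    rcases hb.2.prop.2.total ht hcb with h | h
    · exact Or.inl (hst.trans h)
    · exact List.prefix_or_prefix_of_prefix hst h
  exact hb.2.le_of_ge ⟨Set.insert_subset hs hb.2.prop.1, hc⟩ (Set.subset_insert s b)
    (Set.mem_insert s b)

instance instPartialOrder (T : Set (List ℕ)) : PartialOrder (TreeBar T) where
  le := le
  le_refl x := by
    cases x with
    | node s => exact List.prefix_rfl
    | branch b => exact rfl
  le_trans x y z hxy hyz := by
    cases x <;> cases y <;> cases z <;> simp only [le] at *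
    · exact hxy.trans hyz
    · rename_i s t b
      exact mem_branch_of_prefix b.2 s.2 hxy hyz
    · rename_i s b c
      exact hyz ▸ hxy
    · exact hxy.trans hyz
  le_antisymm x y hxy hyx := by
    cases x <;> cases y <;> simp only [le] at *
    · rename_i s t
      have h : s = t := Subtype.ext (hxy.eq_of_length (le_antisymm hxy.length_le hyx.length_le))
      rw [h]
    · rw [hxy]

instance instTopologicalSpace (T : Set (List ℕ)) : TopologicalSpace (TreeBar T) :=
  coarseWedgeTopology (TreeBar T)

end TreeBar

/-- The sequence `x` is a (Schauder) basis of `X` with basis constant at most `C`. -/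
def IsBasisWithConstLE (𝕜 : Type*) [RCLike 𝕜] {X : Type*} [NormedAddCommGroup X] [NormedSpace 𝕜 X]
    (x : ℕ → X) (C : ℝ) : Prop :=
  ∃ b : SchauderBasis 𝕜 X, (∀ m, b m = x m) ∧ b.enormProjBound ≤ ENNReal.ofReal C

/-- The sequence `x` is a basic sequence, that is, a basis of its closed linear span, with basis
constant at most `C`. -/
def IsBasicWithConstLE (𝕜 : Type*) [RCLike 𝕜] {X : Type*} [NormedAddCommGroup X] [NormedSpace 𝕜 X]
    (x : ℕ → X) (C : ℝ) : Prop :=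
  IsBasisWithConstLE 𝕜 (X := (Submodule.span 𝕜 (Set.range x)).topologicalClosure)
    (fun m => ⟨x m, Submodule.le_topologicalClosure _ (Submodule.subset_span ⟨m, rfl⟩)⟩) C

/-- The common kernel of a family of functionals. -/
def commonKer {𝕜 : Type*} [RCLike 𝕜] {Z : Type*} [NormedAddCommGroup Z] [NormedSpace 𝕜 Z]
    {ι : Type*} (f : ι → StrongDual 𝕜 Z) : Submodule 𝕜 Z :=
  ⨅ i, (f i).toLinearMap.ker

/-- The quotient by the common kernel is a normed space because the common kernel is closed. -/
instance commonKer_isClosed {𝕜 : Type*} [RCLike 𝕜] {Z : Type*} [NormedAddCommGroup Z]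
    [NormedSpace 𝕜 Z] {ι : Type*} (f : ι → StrongDual 𝕜 Z) :
    IsClosed (commonKer f : Set Z) := by
  rw [commonKer, Submodule.coe_iInf]
  exact isClosed_iInter fun i => (f i).isClosed_ker

open Filter Topology

/-! Since `Z` is separable, `K` is weak* metrizable. A Cantor–Bendixson argument then yields a
nonempty `B ⊆ a • K`, with `a < 1`, such that every weak* neighbourhood of a point of `B` contains
infinitely many points of `B`, while `R*` maps distinct points of `B` to functionals more than `a *
ε` apart. Infinitely many such functionals cannot all have norm at most `r < a * ε / 2` on a closed
subspace of finite codimension: modulo functionals of norm at most `r` they would lie in a bounded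
part of a finite-dimensional space (`exists_annihilated_of_infinite`). So arbitrarily weak*-near any
`x ∈ B` there is `x' ∈ B` exceeding `r` at `R w` for a unit vector `w` killed by prescribed finitely
many functionals. The halving is the `2` in `ε / (2 + θ)`; taking `a` close to `1` costs the `θ`.

The nodes are treated in the order of `τ`, with `x n` chosen near the point `x (p n)` of the parent.
The increment `y n = z n - z (p n)` is a small correction of `x n - x (p n)` that makes the `y i`
and `R (w j)` biorthogonal up to scalars (`exists_biorthogonal_extension`). The corrections along a
path stay within `(1 - a) • K`, so `z n ∈ K`. As `z n` is the sum of the increments at the ancestors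
of node `n`, biorthogonality gives (i).

The increments are also geometrically small on a dense sequence. There the sums converge uniformly
over the tree and its branches, and each term is continuous because wedges of nodes are clopen;
boundedness of `K` extends continuity to all of `Z` (`exists_treeBar_extension`).

Finally, each new `w n` is killed by finitely many functionals almost norming the span of the
earlier vectors, which is Mazur's criterion for (iii). Each new `y n` is tiny at finitely many
points almost norming the span of the earlier increments, which makes the increments weak* basic and
gives (iv) by duality. -/

/-- Dependent choice in a form where the `n`-th requirement sees only the values up to `n`, so later
updates cannot spoil it. -/
theorem exists_seq_of_forall_exists_update {α : Type*} [Nonempty α] (Q : ℕ → (ℕ → α) → Prop)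
    (hQ : ∀ n f g, (∀ k ≤ n, f k = g k) → Q n f → Q n g)
    (h : ∀ n f, (∀ k < n, Q k f) → ∃ a, Q n (Function.update f n a)) : ∃ f, ∀ n, Q n f := by
  classical
  have key : ∀ n (f : {f : ℕ → α // ∀ k < n, Q k f}), ∃ a, ∀ k < n + 1,
      Q k (Function.update f.1 n a) := by
    rintro n ⟨f, hf⟩
    obtain ⟨a, ha⟩ := h n f hf
    refine ⟨a, fun k hk => ?_⟩
    rcases Nat.lt_succ_iff_lt_or_eq.1 hk with hk | rfl
    · exact hQ k f _ (fun j hj => (Function.update_of_ne (by omega) _ _).symm) (hf k hk)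
    · exact ha
  choose a ha using key
  let F : ∀ n, {f : ℕ → α // ∀ k < n, Q k f} := fun n => Nat.rec
    ⟨fun _ => Classical.arbitrary α, fun k hk => absurd hk (Nat.not_lt_zero k)⟩
    (fun n f => ⟨Function.update f.1 n (a n f), ha n f⟩) n
  have hF : ∀ n, (F (n + 1)).1 = Function.update (F n).1 n (a n (F n)) := fun n => rfl
  have hst : ∀ k m, k < m → (F m).1 k = (F (k + 1)).1 k := by
    intro k m hkm
    induction m, hkm using Nat.le_induction with
    | base => rfl
    | succ m hm ih => rw [hF, Function.update_of_ne (by omega), ih]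
  refine ⟨fun n => (F (n + 1)).1 n, fun n => ?_⟩
  exact hQ n (F (n + 1)).1 _ (fun k hk => hst k (n + 1) (by omega)) ((F (n + 1)).2 n (by omega))

/-! ### Criteria for bases and basic sequences -/

section Basis

variable {𝕜 : Type*} [RCLike 𝕜] {X : Type*} [NormedAddCommGroup X] [NormedSpace 𝕜 X]

/-- On the span the partial sums are eventually constant; their uniform bound carries convergence
over to the closure. -/
theorem isBasisWithConstLE_of_biorthogonal {x : ℕ → X} {f : ℕ → StrongDual 𝕜 X}
    (hf : ∀ i j, f i (x j) = if i = j then 1 else 0)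
    (hx : Dense (Submodule.span 𝕜 (Set.range x) : Set X)) {C : ℝ}
    (hC : ∀ n v, ‖∑ i ∈ Finset.range n, f i v • x i‖ ≤ C * ‖v‖) :
    IsBasisWithConstLE 𝕜 x C := by
  have hC0 : 0 ≤ C := by
    have h1 := hC 1 (x 0)
    have h0 : x 0 ≠ 0 := fun h => by simpa [h] using hf 0 0
    have : 0 < ‖x 0‖ := norm_pos_iff.2 h0
    simp only [Finset.sum_range_one, hf, if_true, one_smul] at h1
    nlinarith
  have hspan : ∀ v ∈ Submodule.span 𝕜 (Set.range x),
      Tendsto (fun n => ∑ i ∈ Finset.range n, f i v • x i) atTop (𝓝 v) := by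
    intro v hv
    induction hv using Submodule.span_induction with
    | mem v hv =>
      obtain ⟨j, rfl⟩ := hv
      refine tendsto_const_nhds.congr' ?_
      filter_upwards [eventually_gt_atTop j] with n hn
      simp [hf, hn]
    | zero => simp
    | add u v _ _ hu hv =>
      refine (hu.add hv).congr fun n => ?_
      simp [add_smul, Finset.sum_add_distrib]
    | smul c v _ hv =>
      refine (hv.const_smul c).congr fun n => ?_
      simp [Finset.smul_sum, mul_smul]
  have hconv : ∀ v, Tendsto (fun n => ∑ i ∈ Finset.range n, f i v • x i) atTop (𝓝 v) := by
    intro v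
    rw [Metric.tendsto_atTop]
    intro r hr
    obtain ⟨d, hd, hdv⟩ := Metric.dense_iff.1 hx v (r / (2 * (C + 1))) (by positivity)
    obtain ⟨N, hN⟩ := Metric.tendsto_atTop.1 (hspan d hdv) (r / 2) (by positivity)
    refine ⟨N, fun n hn => ?_⟩
    have h1 := hC n (v - d)
    have h2 := hN n hn
    have h3 : ‖v - d‖ < r / (2 * (C + 1)) := by rwa [← dist_eq_norm, dist_comm]
    rw [lt_div_iff₀ (by positivity)] at h3
    rw [dist_eq_norm] at h2 ⊢
    have h4 : ∑ i ∈ Finset.range n, f i v • x i - v =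
        ∑ i ∈ Finset.range n, f i (v - d) • x i + (∑ i ∈ Finset.range n, f i d • x i - d)
          - (v - d) := by
      simp only [map_sub, sub_smul, Finset.sum_sub_distrib]
      abel
    rw [h4]
    have h5 := norm_sub_le (∑ i ∈ Finset.range n, f i (v - d) • x i +
      (∑ i ∈ Finset.range n, f i d • x i - d)) (v - d)
    have h6 := norm_add_le (∑ i ∈ Finset.range n, f i (v - d) • x i)
      (∑ i ∈ Finset.range n, f i d • x i - d)
    nlinarith
  let b : SchauderBasis 𝕜 X :=
    { basis := x
      coord := f
      ortho := fun i j => by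
        rw [hf]
        by_cases h : i = j <;> simp [h]
      expansion := fun v => by
        rw [HasSum, SummationFilter.conditional_filter_eq_map_range, tendsto_map'_iff]
        exact hconv v }
  refine ⟨b, fun _ => rfl, iSup_le fun n => ?_⟩
  rw [← ofReal_norm]
  refine ENNReal.ofReal_le_ofReal (ContinuousLinearMap.opNorm_le_bound _ hC0 fun v => ?_)
  rw [SchauderBasis.proj_apply]
  exact hC n v

/-- Mazur's criterion for basic sequences. -/
theorem isBasicWithConstLE_of_norming {x : ℕ → X} {f : ℕ → StrongDual 𝕜 X}
    (hf : ∀ i j, f i (x j) = if i = j then 1 else 0) {C : ℝ} (hC0 : 0 ≤ C)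
    (hnorm : ∀ n, ∀ v ∈ Submodule.span 𝕜 (x '' Set.Iio n), ∃ g : StrongDual 𝕜 X,
      ‖g‖ ≤ 1 ∧ ‖v‖ ≤ C * ‖g v‖ ∧ ∀ j, n ≤ j → g (x j) = 0) :
    IsBasicWithConstLE 𝕜 x C := by
  set E := (Submodule.span 𝕜 (Set.range x)).topologicalClosure with hE
  refine isBasisWithConstLE_of_biorthogonal (f := fun i => (f i).comp E.subtypeL)
    (fun i j => by simpa using hf i j) ?_ ?_
  · have h1 : ∀ v ∈ Submodule.span 𝕜 (Set.range x), ∀ hv : v ∈ E, (⟨v, hv⟩ : E) ∈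
        Submodule.span 𝕜 (Set.range fun m => (⟨x m, Submodule.le_topologicalClosure _
          (Submodule.subset_span ⟨m, rfl⟩)⟩ : E)) := by
      intro v hv
      induction hv using Submodule.span_induction with
      | mem v hv =>
        obtain ⟨j, rfl⟩ := hv
        exact fun _ => Submodule.subset_span ⟨j, rfl⟩
      | zero => exact fun _ => Submodule.zero_mem _
      | add u v hu hv h1 h2 =>
        exact fun _ => Submodule.add_mem _
          (h1 (Submodule.le_topologicalClosure _ hu)) (h2 (Submodule.le_topologicalClosure _ hv))
      | smul c v hv h =>
        exact fun _ => Submodule.smul_mem _ c (h (Submodule.le_topologicalClosure _ hv))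
    intro v
    rw [Metric.mem_closure_iff]
    intro r hr
    have hv : (v : X) ∈ closure (Submodule.span 𝕜 (Set.range x) : Set X) := v.2
    obtain ⟨u, hu, huv⟩ := Metric.mem_closure_iff.1 hv r hr
    exact ⟨⟨u, Submodule.le_topologicalClosure _ hu⟩, h1 u hu _, huv⟩
  · intro n v
    have hmem : ∑ i ∈ Finset.range n, f i v • x i ∈ Submodule.span 𝕜 (x '' Set.Iio n) :=
      Submodule.sum_mem _ fun i hi => Submodule.smul_mem _ _
        (Submodule.subset_span ⟨i, Finset.mem_range.1 hi, rfl⟩)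
    obtain ⟨g, hg1, hg2, hg3⟩ := hnorm n _ hmem
    -- `g` does not see the tail `x j`, `j ≥ n`, so it takes the same value on `v` and on its
    -- partial sum.
    have hgP : g (∑ i ∈ Finset.range n, f i v • x i) = g v := by
      have : Set.EqOn (g.comp (∑ i ∈ Finset.range n, (f i).smulRight (x i))) g
          (closure (Submodule.span 𝕜 (Set.range x))) := by
        refine ContinuousLinearMap.eqOn_closure_span ?_
        rintro _ ⟨j, rfl⟩
        rcases lt_or_ge j n with hj | hj
        · simp [hf, hj]
        · simp [hf, hg3 j hj, hj.not_gt]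
      simpa using this v.2
    have hle : ‖g v‖ ≤ ‖(v : X)‖ := by
      simpa using (g.le_opNorm v).trans (mul_le_mul_of_nonneg_right hg1 (norm_nonneg _))
    rw [hgP] at hg2
    have h3 := hg2.trans (mul_le_mul_of_nonneg_left hle hC0)
    simpa using h3

/-- A criterion for a sequence to be a basis of a quotient, in terms of a weak* basic sequence
of functionals. -/
theorem isBasisWithConstLE_mkQ_of_norming [CompleteSpace X] (X₀ : Submodule 𝕜 X)
    [IsClosed (X₀ : Set X)] {x : ℕ → X} {f : ℕ → StrongDual 𝕜 X}
    (hX₀ : ∀ v, v ∈ X₀ ↔ ∀ i, f i v = 0)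
    (hf : ∀ i j, f i (x j) = if i = j then 1 else 0) {M β η : ℝ} (hM : ∀ i, ‖x i‖ ≤ M)
    (hβ : 0 ≤ β) (hη : 0 ≤ η) {D : Set X} (hD : Dense D)
    (hDf : ∀ d ∈ D, ∀ᶠ j in atTop, ‖f j d‖ ≤ β * (1 / 2) ^ j)
    (hnorm : ∀ n, ∀ g ∈ Submodule.span 𝕜 (f '' Set.Iio n), ∃ u : X,
      ‖u‖ ≤ 1 ∧ ‖g‖ ≤ (1 + η) * ‖g u‖ ∧ ∀ j, n ≤ j → ‖f j u‖ ≤ β * (1 / 2) ^ j) :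
    IsBasisWithConstLE 𝕜 (fun m => X₀.mkQ (x m)) ((1 + η) * (1 + 2 * M * β)) := by
  have hM0 : 0 ≤ M := (norm_nonneg _).trans (hM 0)
  have hgeo : Summable fun j : ℕ => β * (1 / 2 : ℝ) ^ j := summable_geometric_two.mul_left β
  -- Where the coefficients decay geometrically the expansion converges absolutely, and by
  -- biorthogonality every `f i` kills the remainder.
  have hsum : ∀ d, (∀ᶠ j in atTop, ‖f j d‖ ≤ β * (1 / 2) ^ j) →
      Summable (fun j => f j d • x j) ∧ d - ∑' j, f j d • x j ∈ X₀ := by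
    intro d hd
    have hs : Summable (fun j => f j d • x j) := by
      refine Summable.of_norm_bounded_eventually_nat (hgeo.mul_right M) ?_
      filter_upwards [hd] with j hj
      rw [norm_smul]
      exact mul_le_mul hj (hM j) (norm_nonneg _) (by positivity)
    refine ⟨hs, (hX₀ _).2 fun i => ?_⟩
    rw [map_sub, (f i).map_tsum hs, tsum_eq_single i]
    · simp [hf]
    · intro j hj
      simp [hf, hj.symm]
  have hlift : ∀ i, X₀ ≤ (f i).toLinearMap.ker := fun i v hv => (hX₀ v).1 hv i
  have hdense : Dense (Submodule.span 𝕜 (Set.range fun m => X₀.mkQ (x m)) : Set (X ⧸ X₀)) := by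
    have hsurj : DenseRange (X₀.mkQL : X → X ⧸ X₀) :=
      (Submodule.mkQ_surjective X₀).denseRange
    refine (hsurj.dense_image X₀.mkQL.continuous hD).mono ?_ |>.of_closure
    rintro _ ⟨d, hd, rfl⟩
    obtain ⟨hs, hmem⟩ := hsum d (hDf d hd)
    have h1 : X₀.mkQL d = X₀.mkQL (∑' j, f j d • x j) := by
      rw [← sub_eq_zero, ← map_sub]
      exact (Submodule.Quotient.mk_eq_zero X₀).2 hmem
    rw [h1]
    refine mem_closure_of_tendsto ((X₀.mkQL.continuous.tendsto _).comp hs.hasSum)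
      (Eventually.of_forall fun s => ?_)
    simp only [Function.comp, map_sum, map_smul]
    exact Submodule.sum_mem _ fun i _ => Submodule.smul_mem _ _ (Submodule.subset_span ⟨i, rfl⟩)
  refine isBasisWithConstLE_of_biorthogonal (f := fun i => X₀.liftQL (f i) (hlift i)) ?_ hdense ?_
  · intro i j
    exact hf i j
  · intro n v
    set q := ∑ i ∈ Finset.range n, (X₀.liftQL (f i) (hlift i)) v • X₀.mkQ (x i) with hq
    obtain ⟨φ, hφ1, hφ2⟩ := exists_dual_vector'' 𝕜 q
    set F : StrongDual 𝕜 X := φ.comp X₀.mkQL with hF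
    have hF1 : ∀ u, ‖F u‖ ≤ ‖u‖ := fun u => by
      calc ‖φ (X₀.mkQL u)‖ ≤ ‖φ‖ * ‖X₀.mkQL u‖ := φ.le_opNorm _
        _ ≤ 1 * ‖u‖ := mul_le_mul hφ1 (Submodule.Quotient.norm_mk_le X₀ u) (norm_nonneg _)
          zero_le_one
        _ = ‖u‖ := one_mul _
    have hF0 : ∀ u ∈ X₀, F u = 0 := fun u hu => by
      have : X₀.mkQL u = 0 := (Submodule.Quotient.mk_eq_zero X₀).2 hu
      simp [hF, this]
    -- The adjoint of the partial-sum projection applied to `F`. Its norm is almost attained at some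
    -- `u` where the tail of the expansion is small, so `g u` is close to `F u`.
    set g : StrongDual 𝕜 X := ∑ i ∈ Finset.range n, F (x i) • f i with hg
    have hgmem : g ∈ Submodule.span 𝕜 (f '' Set.Iio n) :=
      Submodule.sum_mem _ fun i hi => Submodule.smul_mem _ _
        (Submodule.subset_span ⟨i, Finset.mem_range.1 hi, rfl⟩)
    obtain ⟨u, hu1, hu2, hu3⟩ := hnorm n g hgmem
    have hgu : ‖g u‖ ≤ 1 + 2 * M * β := by
      obtain ⟨hs, hmem⟩ := hsum u (eventually_atTop.2 ⟨n, hu3⟩)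
      have h1 : F u = ∑' j, f j u * F (x j) := by
        have h2 := hF0 _ hmem
        rw [map_sub, sub_eq_zero, F.map_tsum hs] at h2
        simpa using h2
      have hs' : Summable fun j => f j u * F (x j) := by
        simpa using (F.summable hs)
      have h3 : F u = g u + ∑' j, f (j + n) u * F (x (j + n)) := by
        rw [h1, ← hs'.sum_add_tsum_nat_add n]
        simp [hg, mul_comm]
      have h4 : ‖∑' j, f (j + n) u * F (x (j + n))‖ ≤ M * (β * 2) := by
        refine tsum_of_norm_bounded ((hasSum_geometric_two.mul_left β).mul_left M) fun j => ?_
        rw [norm_mul, mul_comm]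
        refine mul_le_mul ((hF1 _).trans (hM _)) ((hu3 _ (Nat.le_add_left _ _)).trans ?_)
          (norm_nonneg _) hM0
        exact mul_le_mul_of_nonneg_left
          (pow_le_pow_of_le_one (by norm_num) (by norm_num) (Nat.le_add_right _ _)) hβ
      have h5 : g u = F u - ∑' j, f (j + n) u * F (x (j + n)) := by rw [h3]; ring
      rw [h5]
      have := norm_sub_le (F u) (∑' j, f (j + n) u * F (x (j + n)))
      linarith [(hF1 u).trans hu1]
    have hgn : ‖g‖ ≤ (1 + η) * (1 + 2 * M * β) :=
      hu2.trans (mul_le_mul_of_nonneg_left hgu (by positivity))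
    let G : StrongDual 𝕜 (X ⧸ X₀) := ∑ i ∈ Finset.range n, F (x i) • X₀.liftQL (f i) (hlift i)
    have hGq : G v = (‖q‖ : 𝕜) := by
      rw [← hφ2, hq]
      simp [G, hF, mul_comm]
    have hGv : ‖G v‖ ≤ ‖g‖ * ‖v‖ := by
      refine le_of_forall_pos_le_add fun r hr => ?_
      obtain ⟨m, rfl, hm⟩ := Submodule.Quotient.norm_mk_lt v
        (show 0 < r / (‖g‖ + 1) by positivity)
      have h1 : G (Submodule.Quotient.mk m) = g m := by
        simp only [G, hg, sum_apply, smul_apply]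
        rfl
      rw [h1]
      refine (g.le_opNorm m).trans ?_
      have h2 : ‖g‖ * (r / (‖g‖ + 1)) ≤ r := by
        rw [mul_div_assoc', div_le_iff₀ (by positivity)]
        nlinarith [norm_nonneg g]
      nlinarith [norm_nonneg g]
    rw [hGq] at hGv
    simp only [RCLike.norm_ofReal, abs_norm] at hGv
    exact hGv.trans (mul_le_mul_of_nonneg_right hgn (norm_nonneg _))

end Basis

/-! ### Finite norming sets and separated functionals -/

section Norming

variable {𝕜 : Type*} [RCLike 𝕜]

/-- Compactness of the unit sphere and homogeneity; the strict inequality makes the covering sets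
open. -/
theorem exists_finset_norming {E : Type*} [NormedAddCommGroup E] [NormedSpace 𝕜 E]
    [FiniteDimensional 𝕜 E] {ι : Type*} (e : ι → StrongDual 𝕜 E) {C : ℝ}
    (h : ∀ v, ‖v‖ = 1 → ∃ i, 1 < C * ‖e i v‖) :
    ∃ s : Finset ι, ∀ v ≠ 0, ∃ i ∈ s, ‖v‖ ≤ C * ‖e i v‖ := by
  have : ProperSpace E := FiniteDimensional.proper 𝕜 E
  obtain ⟨s, hs⟩ := (isCompact_sphere (0 : E) 1).elim_finite_subcover
    (fun i => {v | 1 < C * ‖e i v‖})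
    (fun i => isOpen_lt continuous_const (by fun_prop))
    (fun v hv => by simpa using h v (by simpa using hv))
  refine ⟨s, fun v hv => ?_⟩
  have hv' : 0 < ‖v‖ := norm_pos_iff.2 hv
  have hu : ((‖v‖⁻¹ : ℝ) : 𝕜) • v ∈ Metric.sphere (0 : E) 1 := by
    simp [norm_smul, hv'.ne']
  obtain ⟨i, hi, hlt⟩ := Set.mem_iUnion₂.1 (hs hu)
  refine ⟨i, hi, ?_⟩
  simp only [Set.mem_ofPred_eq, map_smul, norm_smul, RCLike.norm_ofReal, abs_inv, abs_norm] at hlt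
  have h1 : ‖v‖ * 1 ≤ ‖v‖ * (C * (‖v‖⁻¹ * ‖e i v‖)) := mul_le_mul_of_nonneg_left hlt.le hv'.le
  calc ‖v‖ = ‖v‖ * 1 := (mul_one _).symm
    _ ≤ ‖v‖ * (C * (‖v‖⁻¹ * ‖e i v‖)) := h1
    _ = C * ‖e i v‖ := by field_simp

variable {X : Type*} [NormedAddCommGroup X] [NormedSpace 𝕜 X]

theorem exists_finset_dual_norming (V : Submodule 𝕜 X) [FiniteDimensional 𝕜 V] {η : ℝ}
    (hη : 0 < η) : ∃ G : Finset (StrongDual 𝕜 X), (∀ g ∈ G, ‖g‖ ≤ 1) ∧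
      ∀ v ∈ V, ∃ g ∈ G, ‖v‖ ≤ (1 + η) * ‖g v‖ := by
  classical
  obtain ⟨s, hs⟩ := exists_finset_norming (E := V) (C := 1 + η)
    (fun g : {g : StrongDual 𝕜 X // ‖g‖ ≤ 1} => g.1.comp V.subtypeL) (fun v hv => by
      obtain ⟨g, hg1, hg2⟩ := exists_dual_vector'' 𝕜 (v : X)
      refine ⟨⟨g, hg1⟩, ?_⟩
      have : ‖(v : X)‖ = 1 := hv
      simp [hg2, this, hη])
  -- Adjoining `0` serves `v = 0`, since `s` may be empty when `V` is trivial.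
  refine ⟨insert 0 (s.image Subtype.val), ?_, fun v hv => ?_⟩
  · intro g hg
    rcases Finset.mem_insert.1 hg with rfl | hg
    · simp
    · obtain ⟨g', -, rfl⟩ := Finset.mem_image.1 hg
      exact g'.2
  · by_cases h0 : v = 0
    · exact ⟨0, Finset.mem_insert_self _ _, by simp [h0]⟩
    · obtain ⟨g, hg, hgv⟩ := hs ⟨v, hv⟩ (by simpa using h0)
      exact ⟨g, Finset.mem_insert_of_mem (Finset.mem_image_of_mem _ hg), hgv⟩

theorem exists_finset_predual_norming (V : Submodule 𝕜 (StrongDual 𝕜 X)) [FiniteDimensional 𝕜 V]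
    {η : ℝ} (hη : 0 < η) : ∃ S : Finset X, (∀ u ∈ S, ‖u‖ ≤ 1) ∧
      ∀ g ∈ V, ∃ u ∈ S, ‖g‖ ≤ (1 + η) * ‖g u‖ := by
  classical
  obtain ⟨s, hs⟩ := exists_finset_norming (E := V) (C := 1 + η)
    (fun u : {u : X // ‖u‖ ≤ 1} => (ContinuousLinearMap.apply 𝕜 𝕜 u.1).comp V.subtypeL)
    (fun g hg => by
      have hg' : ‖(g : StrongDual 𝕜 X)‖ = 1 := hg
      by_contra! hcon
      have h1 : ‖(g : StrongDual 𝕜 X)‖ ≤ (1 + η)⁻¹ := by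
        refine ContinuousLinearMap.opNorm_le_of_unit_norm (by positivity) fun u hu => ?_
        have h2 : (1 + η) * ‖(g : StrongDual 𝕜 X) u‖ ≤ 1 := by simpa using hcon ⟨u, hu.le⟩
        rw [inv_eq_one_div, le_div_iff₀ (by positivity)]
        linarith
      rw [hg', inv_eq_one_div, le_div_iff₀ (by positivity)] at h1
      linarith)
  refine ⟨insert 0 (s.image Subtype.val), ?_, fun g hg => ?_⟩
  · intro u hu
    rcases Finset.mem_insert.1 hu with rfl | hu
    · simp
    · obtain ⟨u', -, rfl⟩ := Finset.mem_image.1 hu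
      exact u'.2
  · by_cases h0 : g = 0
    · exact ⟨0, Finset.mem_insert_self _ _, by simp [h0]⟩
    · obtain ⟨u, hu, hgu⟩ := hs ⟨g, hg⟩ (by simpa using h0)
      exact ⟨u, Finset.mem_insert_of_mem (Finset.mem_image_of_mem _ hu), hgu⟩

/-- If the kernels of finitely many functionals intersect inside the kernel of `k`, then `k` lies
in their span. -/
theorem mem_span_of_forall_apply_eq_zero (F : Finset (StrongDual 𝕜 X)) {k : StrongDual 𝕜 X}
    (hk : ∀ v, (∀ g ∈ F, g v = 0) → k v = 0) :
    k ∈ Submodule.span 𝕜 (F : Set (StrongDual 𝕜 X)) := by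
  have h1 : (k : X →ₗ[𝕜] 𝕜) ∈ Submodule.span 𝕜
      (Set.range fun g : F => ((g : StrongDual 𝕜 X) : X →ₗ[𝕜] 𝕜)) := by
    refine mem_span_of_iInf_ker_le_ker fun v hv => ?_
    simp only [Submodule.mem_iInf, LinearMap.mem_ker] at hv
    exact hk v fun g hg => hv ⟨g, hg⟩
  obtain ⟨c, hc⟩ := (Submodule.mem_span_range_iff_exists_fun 𝕜).1 h1
  have h2 : k = ∑ g : F, c g • (g : StrongDual 𝕜 X) := by
    ext v
    have := LinearMap.congr_fun hc v
    simpa using this.symm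
  rw [h2]
  exact Submodule.sum_mem _ fun g _ => Submodule.smul_mem _ _ (Submodule.subset_span g.2)

theorem exists_norm_eq_one_of_lt_norm {V : Submodule 𝕜 X} {f : StrongDual 𝕜 X} {r : ℝ} {v : X}
    (hv : v ∈ V) (hr : 0 ≤ r) (h : r * ‖v‖ < ‖f v‖) :
    ∃ w ∈ V, ‖w‖ = 1 ∧ ∃ c : ℝ, r < c ∧ f w = c := by
  have hfv : 0 < ‖f v‖ := lt_of_le_of_lt (by positivity) h
  have hv0 : v ≠ 0 := fun h0 => by simp [h0] at hfv
  have hvn : 0 < ‖v‖ := norm_pos_iff.2 hv0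
  have hf0 : f v ≠ 0 := norm_pos_iff.1 hfv
  -- The scalar has modulus `1 / ‖v‖`, and its phase makes the value of `f` real and positive.
  refine ⟨((‖f v‖ / ‖v‖ : ℝ) / f v : 𝕜) • v, V.smul_mem _ hv, ?_, ‖f v‖ / ‖v‖, ?_, ?_⟩
  · rw [norm_smul, norm_div, RCLike.norm_ofReal, abs_of_pos (by positivity)]
    field_simp
  · rwa [lt_div_iff₀ hvn]
  · rw [map_smul, smul_eq_mul, div_mul_cancel₀ _ hf0]

/-- Among infinitely many `ε`-separated, uniformly bounded functionals, one has norm greater than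
`r < ε / 2` on a given closed subspace of finite codimension. -/
theorem exists_annihilated_of_infinite {B : Set (StrongDual 𝕜 X)} (hB : B.Infinite) {M ε r : ℝ}
    (hM : ∀ x ∈ B, ‖x‖ ≤ M) (hsep : ∀ x ∈ B, ∀ y ∈ B, x ≠ y → ε < ‖x - y‖) (hr : 0 ≤ r)
    (hrε : 2 * r < ε) (F : Finset (StrongDual 𝕜 X)) :
    ∃ x ∈ B, ∃ w, ‖w‖ = 1 ∧ (∀ g ∈ F, g w = 0) ∧ ∃ c : ℝ, r < c ∧ x w = c := by
  by_contra! hcon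
  let V : Submodule 𝕜 X := ⨅ g ∈ F, LinearMap.ker (g : X →ₗ[𝕜] 𝕜)
  have hV : ∀ v, v ∈ V ↔ ∀ g ∈ F, g v = 0 := by
    intro v
    simp [V, Submodule.mem_iInf]
  -- If the conclusion fails, each `x ∈ B` has norm at most `r` on `V`, and Hahn–Banach extends that
  -- restriction without increasing the norm.
  have hsmall : ∀ x ∈ B, ∃ h : StrongDual 𝕜 X, ‖h‖ ≤ r ∧ ∀ v ∈ V, h v = x v := by
    intro x hx
    obtain ⟨h, hh, hn⟩ := exists_extension_norm_eq V (x.comp V.subtypeL)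
    refine ⟨h, ?_, fun v hv => hh ⟨v, hv⟩⟩
    rw [hn]
    refine ContinuousLinearMap.opNorm_le_bound _ hr fun v => ?_
    by_contra! hlt
    obtain ⟨w, hwV, hw1, c, hc, hxw⟩ := exists_norm_eq_one_of_lt_norm v.2 hr hlt
    exact hcon x hx w hw1 ((hV w).1 hwV) c hc hxw
  choose! h hhr hhV using hsmall
  let E := Submodule.span 𝕜 (F : Set (StrongDual 𝕜 X))
  have hE : ∀ x ∈ B, x - h x ∈ E := fun x hx =>
    mem_span_of_forall_apply_eq_zero F fun v hv => by simp [hhV x hx v ((hV v).2 hv)]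
  have : FiniteDimensional 𝕜 E := FiniteDimensional.span_of_finite 𝕜 F.finite_toSet
  have : ProperSpace E := FiniteDimensional.proper 𝕜 E
  let s : ℕ ↪ B := hB.natEmbedding
  let k : ℕ → E := fun n => ⟨(s n : StrongDual 𝕜 X) - h (s n), hE _ (s n).2⟩
  have hk : ∀ n, k n ∈ Metric.closedBall (0 : E) (M + r) := by
    intro n
    rw [Metric.mem_closedBall, Subtype.dist_eq]
    refine (dist_zero_right _).trans_le ?_
    exact (norm_sub_le (s n : StrongDual 𝕜 X) (h (s n))).trans
      (add_le_add (hM _ (s n).2) (hhr _ (s n).2))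
  obtain ⟨a, -, φ, hφ, hlim⟩ := (isCompact_closedBall (0 : E) (M + r)).tendsto_subseq hk
  -- Two differences `x - h x` closer than `ε - 2 * r` put the two points `x` closer than `ε`, as
  -- each `h x` has norm at most `r`.
  obtain ⟨N, hN⟩ := Metric.cauchySeq_iff.1 hlim.cauchySeq (ε - 2 * r) (by linarith)
  have hd := hN N le_rfl (N + 1) (Nat.le_succ N)
  have hne : (s (φ N) : StrongDual 𝕜 X) ≠ s (φ (N + 1)) := fun he =>
    (hφ (Nat.lt_succ_self N)).ne (s.injective (Subtype.ext he))
  have h1 := hsep _ (s (φ N)).2 _ (s (φ (N + 1))).2 hne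
  have h2 : dist (k (φ N)) (k (φ (N + 1))) =
      ‖((s (φ N) : StrongDual 𝕜 X) - h (s (φ N))) - (s (φ (N + 1)) - h (s (φ (N + 1))))‖ := by
    rw [Subtype.dist_eq]
    exact dist_eq_norm _ _
  simp only [Function.comp] at hd
  rw [h2] at hd
  have h3 : (s (φ N) : StrongDual 𝕜 X) - s (φ (N + 1)) =
      (((s (φ N) : StrongDual 𝕜 X) - h (s (φ N))) - (s (φ (N + 1)) - h (s (φ (N + 1))))) +
        (h (s (φ N)) - h (s (φ (N + 1)))) := by abel
  rw [h3] at h1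
  have h4 := norm_add_le
    (((s (φ N) : StrongDual 𝕜 X) - h (s (φ N))) - (s (φ (N + 1)) - h (s (φ (N + 1)))))
    (h (s (φ N)) - h (s (φ (N + 1))))
  have h5 := norm_sub_le (h (s (φ N))) (h (s (φ (N + 1))))
  linarith [hhr _ (s (φ N)).2, hhr _ (s (φ (N + 1))).2]

end Norming

/-! ### Weak* condensation in an uncountable set -/

section Perfect

/-- Cantor–Bendixson: discarding a countable set from `S` leaves a perfect set, nonempty because `S`
is uncountable, and in a T1 space accumulation points have infinitely many neighbours. -/
theorem exists_subset_forall_infinite_inter {α : Type*} [TopologicalSpace α] [T1Space α]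
    {S : Set α} [SecondCountableTopology S] (hS : ¬ S.Countable) :
    ∃ B ⊆ S, B.Nonempty ∧ ∀ x ∈ B, ∀ N ∈ 𝓝 x, (N ∩ B).Infinite := by
  obtain ⟨V, D, hV, hD, hVD⟩ := exists_countable_union_perfect_of_isClosed
    (isClosed_univ (X := S))
  refine ⟨Subtype.val '' D, by simp, ?_, ?_⟩
  · rw [Set.image_nonempty, Set.nonempty_iff_ne_empty]
    rintro rfl
    rw [Set.union_empty] at hVD
    rw [← hVD, Set.countable_univ_iff] at hV
    exact hS hV
  · rintro _ ⟨x, hx, rfl⟩ N hN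
    have h1 := (hD.acc x hx).nhds_inter (continuous_subtype_val.continuousAt.preimage_mem_nhds hN)
    refine ((Set.Infinite.of_accPt h1).image Subtype.val_injective.injOn).mono ?_
    rintro _ ⟨y, ⟨hy1, hy2⟩, rfl⟩
    exact ⟨hy1, y, hy2, rfl⟩

variable {𝕜 : Type*} [RCLike 𝕜] {Z : Type*} [NormedAddCommGroup Z] [NormedSpace 𝕜 Z]

theorem exists_norm_le_of_isCompact_toWeakDual [CompleteSpace Z] {K : Set (StrongDual 𝕜 Z)}
    (hK : IsCompact (StrongDual.toWeakDual '' K)) : ∃ M, ∀ f ∈ K, ‖f‖ ≤ M := by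
  have h : ∀ v : Z, ∃ C, ∀ f : K, ‖(f : StrongDual 𝕜 Z) v‖ ≤ C := by
    intro v
    obtain ⟨C, hC⟩ := (hK.image (WeakDual.eval_continuous v)).isBounded.exists_norm_le
    exact ⟨C, fun f => hC _ ⟨_, ⟨f, f.2, rfl⟩, rfl⟩⟩
  obtain ⟨M, hM⟩ := banach_steinhaus h
  exact ⟨M, fun f hf => hM ⟨f, hf⟩⟩

/-- Separability of `Z` makes the weak* compact `K` metrizable, hence second countable, so the
Cantor–Bendixson argument applies in the weak* topology. -/
theorem exists_subset_forall_infinite_near [TopologicalSpace.SeparableSpace Z]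
    {K : Set (StrongDual 𝕜 Z)} (hK : IsCompact (StrongDual.toWeakDual '' K))
    {S : Set (StrongDual 𝕜 Z)} (hSK : S ⊆ K) (hS : ¬ S.Countable) :
    ∃ B ⊆ S, B.Nonempty ∧ ∀ x ∈ B, ∀ (U : Finset Z) (γ : ℝ), 0 < γ →
      {x' ∈ B | ∀ u ∈ U, ‖(x' - x) u‖ < γ}.Infinite := by
  let e : StrongDual 𝕜 Z → WeakDual 𝕜 Z := StrongDual.toWeakDual
  have he : Function.Injective e := StrongDual.toWeakDual.injective
  have : TopologicalSpace.MetrizableSpace (e '' K) := WeakDual.metrizable_of_isCompact 𝕜 Z _ hK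
  have : CompactSpace (e '' K) := isCompact_iff_compactSpace.1 hK
  let _ := TopologicalSpace.metrizableSpaceMetric (e '' K)
  have : SecondCountableTopology (e '' K) := inferInstance
  have : SecondCountableTopology (e '' S) :=
    (Topology.IsEmbedding.inclusion (Set.image_mono hSK)).secondCountableTopology
  have hS' : ¬ (e '' S).Countable := fun h => hS (Set.countable_of_injective_of_countable_image he.injOn h)
  obtain ⟨B, hBS, hBne, hB⟩ := exists_subset_forall_infinite_inter hS'
  obtain ⟨B, hBS', rfl⟩ := Set.subset_image_iff.1 hBS
  refine ⟨B, hBS', Set.image_nonempty.1 hBne, fun x hx U γ hγ => ?_⟩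
  have hN : {f : WeakDual 𝕜 Z | ∀ u ∈ U, ‖f u - x u‖ < γ} ∈ 𝓝 (e x) := by
    have : {f : WeakDual 𝕜 Z | ∀ u ∈ U, ‖f u - x u‖ < γ} =
        ⋂ u ∈ U, {f : WeakDual 𝕜 Z | ‖f u - x u‖ < γ} := by
      ext f
      simp
    rw [this, Filter.biInter_finset_mem]
    intro u hu
    have hc : Continuous fun f : WeakDual 𝕜 Z => ‖f u - x u‖ :=
      ((WeakDual.eval_continuous u).sub continuous_const).norm
    refine (isOpen_lt hc continuous_const).mem_nhds ?_
    have : (e x) u = x u := rfl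
    simpa [this] using hγ
  refine Set.Infinite.of_image e ((hB _ ⟨x, hx, rfl⟩ _ hN).mono ?_)
  rintro _ ⟨hf, x', hx', rfl⟩
  exact ⟨x', ⟨hx', hf⟩, rfl⟩

end Perfect

/-! ### Dilates of an absolutely convex set -/

section AbsConvex

variable {𝕜 : Type*} [RCLike 𝕜] {E : Type*} [AddCommGroup E] [Module 𝕜 E] {K : Set E}

/-- Absolute convexity spelled out with real convex coefficients, through the scalar
multiplication of the module structure. -/
structure IsAbsConvexSet (𝕜 : Type*) [RCLike 𝕜] {E : Type*} [AddCommGroup E] [Module 𝕜 E]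
    (K : Set E) : Prop where
  nonempty : K.Nonempty
  smul_mem : ∀ c : 𝕜, ‖c‖ ≤ 1 → ∀ k ∈ K, c • k ∈ K
  convex : ∀ a b : ℝ, 0 ≤ a → 0 ≤ b → a + b = 1 → ∀ k ∈ K, ∀ l ∈ K,
    (a : 𝕜) • k + (b : 𝕜) • l ∈ K

/-- The dilate `r • K` by a real number. -/
def dilate (𝕜 : Type*) [RCLike 𝕜] {E : Type*} [AddCommGroup E] [Module 𝕜 E] (K : Set E)
    (r : ℝ) : Set E :=
  {f | ∃ k ∈ K, f = (r : 𝕜) • k}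

theorem dilate_one : dilate 𝕜 K 1 = K := by
  ext f
  simp [dilate]

namespace IsAbsConvexSet

theorem zero_mem (hK : IsAbsConvexSet 𝕜 K) : (0 : E) ∈ K := by
  obtain ⟨k, hk⟩ := hK.nonempty
  simpa using hK.smul_mem 0 (by simp) k hk

theorem zero_mem_dilate (hK : IsAbsConvexSet 𝕜 K) (r : ℝ) : (0 : E) ∈ dilate 𝕜 K r :=
  ⟨0, hK.zero_mem, by simp⟩

theorem add_mem_dilate (hK : IsAbsConvexSet 𝕜 K) {r s : ℝ} (hr : 0 ≤ r) (hs : 0 ≤ s)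
    {f g : E} (hf : f ∈ dilate 𝕜 K r) (hg : g ∈ dilate 𝕜 K s) : f + g ∈ dilate 𝕜 K (r + s) := by
  obtain ⟨k, hk, rfl⟩ := hf
  obtain ⟨l, hl, rfl⟩ := hg
  -- The convex weights `r / (r + s)` and `s / (r + s)` need `r + s ≠ 0`.
  rcases (add_nonneg hr hs).eq_or_lt with h0 | h0
  · obtain ⟨rfl, rfl⟩ := (add_eq_zero_iff_of_nonneg hr hs).1 h0.symm
    exact ⟨k, hk, by simp⟩
  · refine ⟨((r / (r + s) : ℝ) : 𝕜) • k + ((s / (r + s) : ℝ) : 𝕜) • l,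
      hK.convex _ _ (by positivity) (by positivity) ?_ k hk l hl, ?_⟩
    · rw [← add_div, div_self h0.ne']
    · simp only [smul_add, smul_smul, ← RCLike.ofReal_mul]
      rw [mul_div_cancel₀ _ h0.ne', mul_div_cancel₀ _ h0.ne']

theorem smul_mem_dilate (hK : IsAbsConvexSet 𝕜 K) {r s : ℝ} {c : 𝕜} (hs : 0 ≤ s)
    (h : ‖c‖ * |r| ≤ s) {f : E} (hf : f ∈ dilate 𝕜 K r) : c • f ∈ dilate 𝕜 K s := by
  obtain ⟨k, hk, rfl⟩ := hf
  rw [smul_smul]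
  rcases hs.eq_or_lt with rfl | hs
  · have : c * (r : 𝕜) = 0 := by
      rw [← norm_eq_zero, norm_mul, RCLike.norm_ofReal]
      exact le_antisymm h (by positivity)
    exact ⟨k, hk, by simp [this]⟩
  · have hs' : (s : 𝕜) ≠ 0 := by exact_mod_cast hs.ne'
    refine ⟨(c * r / s) • k, hK.smul_mem (c * r / s) ?_ k hk, ?_⟩
    · rw [norm_div, norm_mul, RCLike.norm_ofReal, RCLike.norm_ofReal, abs_of_pos hs]
      exact (div_le_one hs).2 h
    · rw [smul_smul, mul_div_cancel₀ _ hs']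

theorem dilate_mono (hK : IsAbsConvexSet 𝕜 K) {r s : ℝ} (hr : 0 ≤ r) (hrs : r ≤ s) :
    dilate 𝕜 K r ⊆ dilate 𝕜 K s := fun f hf => by
  simpa using hK.smul_mem_dilate (c := (1 : 𝕜)) (hr.trans hrs)
    (by simpa [abs_of_nonneg hr] using hrs) hf

theorem sum_mem_dilate (hK : IsAbsConvexSet 𝕜 K) {ι : Type*}
    (s : Finset ι) {r : ι → ℝ} (hr : ∀ i ∈ s, 0 ≤ r i) {f : ι → E}
    (hf : ∀ i ∈ s, f i ∈ dilate 𝕜 K (r i)) : ∑ i ∈ s, f i ∈ dilate 𝕜 K (∑ i ∈ s, r i) := by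
  classical
  induction s using Finset.induction_on with
  | empty => exact hK.zero_mem_dilate _
  | insert i s hi ih =>
    rw [Finset.sum_insert hi, Finset.sum_insert hi]
    exact hK.add_mem_dilate (hr i (Finset.mem_insert_self _ _))
      (Finset.sum_nonneg fun j hj => hr j (Finset.mem_insert_of_mem hj))
      (hf i (Finset.mem_insert_self _ _))
      (ih (fun j hj => hr j (Finset.mem_insert_of_mem hj))
        (fun j hj => hf j (Finset.mem_insert_of_mem hj)))

theorem mem_of_sub_mem_dilate (hK : IsAbsConvexSet 𝕜 K) {a s : ℝ}
    (ha : 0 ≤ a) (hs : 0 ≤ s) (has : a + s ≤ 1) {x z : E} (hx : x ∈ dilate 𝕜 K a)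
    (hzx : z - x ∈ dilate 𝕜 K s) : z ∈ K := by
  have h1 := hK.add_mem_dilate ha hs hx hzx
  rw [add_sub_cancel] at h1
  have h2 := hK.dilate_mono (add_nonneg ha hs) has h1
  rwa [dilate_one] at h2

end IsAbsConvexSet

theorem AbsConvex.isAbsConvexSet {Z : Type*} [NormedAddCommGroup Z] [NormedSpace 𝕜 Z]
    {K : Set (StrongDual 𝕜 Z)} (hK : AbsConvex 𝕜 K) (hne : K.Nonempty) : IsAbsConvexSet 𝕜 K where
  nonempty := hne
  smul_mem c hc k hk := hK.1 c hc ⟨k, hk, rfl⟩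
  convex a b ha hb hab k hk l hl := hK.2 hk hl (RCLike.ofReal_nonneg.2 ha)
    (RCLike.ofReal_nonneg.2 hb) (by rw [← RCLike.ofReal_add, hab, RCLike.ofReal_one])

end AbsConvex

/-! ### The inductive construction -/

section Construction

variable {𝕜 : Type*} [RCLike 𝕜] {W : Type*} [NormedAddCommGroup W] [NormedSpace 𝕜 W]
  {Z : Type*} [NormedAddCommGroup Z] [NormedSpace 𝕜 Z]

/-- The extension step: a new functional `y'` and a new vector `w'`, biorthogonal to the ones
already chosen. The functional `y'` is small on the finite set `U` and it is close, in the gauge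
of `K`, to a difference `x - xp` with `x ∈ B`. -/
theorem exists_biorthogonal_extension (R : W →L[𝕜] Z) {K B : Set (StrongDual 𝕜 Z)}
    (hK : IsAbsConvexSet 𝕜 K) (hBne : B.Nonempty) {M ε r : ℝ}
    (hBM : ∀ x ∈ B, ‖x.comp R‖ ≤ M)
    (hsep : ∀ x ∈ B, ∀ y ∈ B, x ≠ y → ε < ‖x.comp R - y.comp R‖)
    (hnear : ∀ x ∈ B, ∀ (U : Finset Z) (γ : ℝ), 0 < γ →
      {x' ∈ B | ∀ u ∈ U, ‖(x' - x) u‖ < γ}.Infinite)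
    (hr : 0 < r) (hrε : 2 * r < ε) {n : ℕ} {y : ℕ → StrongDual 𝕜 Z} {w : ℕ → W}
    (hyw : ∀ i < n, ∀ j < n, i ≠ j → y i (R (w j)) = 0)
    (hc : ∀ i < n, ∃ c : ℝ, r < c ∧ y i (R (w i)) = c)
    (hyK : ∀ i < n, y i ∈ dilate 𝕜 K 2) (xp : StrongDual 𝕜 Z)
    (F : Finset (StrongDual 𝕜 W)) (U : Finset Z) (hxp : xp ∈ B ∨ n = 0 ∧ U = ∅) {κ : ℝ}
    (hκ : 0 < κ) :
    ∃ x ∈ B, ∃ (y' : StrongDual 𝕜 Z) (w' : W), ‖w'‖ = 1 ∧ (∀ g ∈ F, g w' = 0) ∧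
      (∀ k < n, y' (R (w k)) = 0) ∧ (∀ k < n, y k (R w') = 0) ∧
      (∃ c : ℝ, r < c ∧ y' (R w') = c) ∧ (∀ u ∈ U, ‖y' u‖ ≤ κ) ∧
      y' - (x - xp) ∈ dilate 𝕜 K κ := by
  classical
  -- Infinite subsets of `B` keep infinite images under the adjoint of `R`.
  have hinj : Set.InjOn (fun x : StrongDual 𝕜 Z => x.comp R) B := by
    intro x hx y hy hxy
    by_contra hne
    have h1 := hsep x hx y hy hne
    simp only at hxy
    rw [hxy, sub_self, norm_zero] at h1
    linarith
  set Y : ℝ := ∑ u ∈ U, ∑ k ∈ Finset.range n, ‖y k u‖ with hY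
  have hY0 : 0 ≤ Y := Finset.sum_nonneg fun _ _ => Finset.sum_nonneg fun _ _ => norm_nonneg _
  -- The denominator pays for `x - xp` on `U`, for the correction on `U`, and for the correction in
  -- the gauge of `K`: there are `n` terms with coefficients at most `γ / r`, each multiplying an
  -- element of `2 • K`.
  set γ : ℝ := κ / (1 + Y / r + 2 * n / r) with hγ
  have hden : 0 < 1 + Y / r + 2 * n / r := by positivity
  have hγ0 : 0 < γ := div_pos hκ hden
  have hγκ : γ + γ / r * Y + n * (γ / r * 2) = κ := by
    have : γ * (1 + Y / r + 2 * n / r) = κ := div_mul_cancel₀ _ hden.ne'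
    rw [← this]
    ring
  set U' : Finset Z := U ∪ (Finset.range n).image fun k => R (w k) with hU'
  have hinf : {x' ∈ B | ∀ u ∈ U', ‖(x' - xp) u‖ < γ}.Infinite := by
    rcases hxp with hxp | ⟨rfl, rfl⟩
    · exact hnear xp hxp U' γ hγ0
    · obtain ⟨x0, hx0⟩ := hBne
      refine (hnear x0 hx0 ∅ 1 one_pos).mono fun x hx => ⟨hx.1, ?_⟩
      simp [hU']
  set B' := {x' ∈ B | ∀ u ∈ U', ‖(x' - xp) u‖ < γ} with hB'
  have hB'B : B' ⊆ B := fun x hx => hx.1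
  -- Including `xp.comp R` ensures that `x - xp` has at `R w'` the same value as `x`.
  set F' : Finset (StrongDual 𝕜 W) :=
    insert (xp.comp R) (F ∪ (Finset.range n).image fun k => (y k).comp R) with hF'
  obtain ⟨_, ⟨x, hx, rfl⟩, w', hw1, hw2, c, hrc, hxw⟩ := exists_annihilated_of_infinite
    (hinf.image (hinj.mono hB'B)) (M := M) (ε := ε) (r := r)
    (by rintro _ ⟨x, hx, rfl⟩; exact hBM x hx.1)
    (by
      rintro _ ⟨x, hx, rfl⟩ _ ⟨x', hx', rfl⟩ hne
      exact hsep x hx.1 x' hx'.1 fun h => hne (by rw [h])) hr.le hrε F'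
  have hxpw : xp (R w') = 0 := hw2 _ (Finset.mem_insert_self _ _)
  have hyw' : ∀ k < n, y k (R w') = 0 := fun k hk => hw2 ((y k).comp R)
    (Finset.mem_insert_of_mem (Finset.mem_union_right _
      (Finset.mem_image_of_mem _ (Finset.mem_range.2 hk))))
  have hFw : ∀ g ∈ F, g w' = 0 := fun g hg =>
    hw2 g (Finset.mem_insert_of_mem (Finset.mem_union_left _ hg))
  -- A Gram–Schmidt step: subtracting `a k • y k` removes the value at `R (w k)` and changes nothing
  -- at the other `R (w j)` or at `R w'`.
  set a : ℕ → 𝕜 := fun k => (x - xp) (R (w k)) / y k (R (w k)) with ha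
  have hcn : ∀ k < n, r < ‖y k (R (w k))‖ := by
    intro k hk
    obtain ⟨c, hc1, hc2⟩ := hc k hk
    rw [hc2, RCLike.norm_ofReal, abs_of_pos (hr.trans hc1)]
    exact hc1
  have han : ∀ k < n, ‖a k‖ ≤ γ / r := by
    intro k hk
    have h1 := hx.2 (R (w k)) (Finset.mem_union_right _
      (Finset.mem_image_of_mem _ (Finset.mem_range.2 hk)))
    rw [ha, norm_div]
    exact div_le_div₀ hγ0.le h1.le hr (hcn k hk).le
  refine ⟨x, hx.1, (x - xp) - ∑ k ∈ Finset.range n, a k • y k, w', hw1, hFw, ?_, hyw',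
    ⟨c, hrc, ?_⟩, ?_, ?_⟩
  · intro k hk
    have h0 : y k (R (w k)) ≠ 0 := norm_pos_iff.1 (hr.trans (hcn k hk))
    have h1 : (∑ j ∈ Finset.range n, a j • y j) (R (w k)) = a k * y k (R (w k)) := by
      rw [sum_apply, Finset.sum_eq_single_of_mem k (Finset.mem_range.2 hk)]
      · rfl
      · intro j hj hjk
        simp [hyw j (Finset.mem_range.1 hj) k hk hjk]
    rw [sub_apply, h1, ha]
    simp only
    rw [div_mul_cancel₀ _ h0, sub_self]
  · have h1 : (∑ j ∈ Finset.range n, a j • y j) (R w') = 0 := by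
      rw [sum_apply]
      exact Finset.sum_eq_zero fun j hj => by simp [hyw' j (Finset.mem_range.1 hj)]
    rw [sub_apply, h1, sub_apply, hxpw, sub_zero, sub_zero]
    exact hxw
  · intro u hu
    have h1 := hx.2 u (Finset.mem_union_left _ hu)
    have h2 : ‖(∑ j ∈ Finset.range n, a j • y j) u‖ ≤ γ / r * Y := by
      rw [sum_apply]
      calc ‖∑ j ∈ Finset.range n, (a j • y j) u‖ ≤ ∑ j ∈ Finset.range n, γ / r * ‖y j u‖ := by
            refine norm_sum_le_of_le _ fun j hj => ?_
            rw [smul_apply, norm_smul]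
            exact mul_le_mul_of_nonneg_right (han j (Finset.mem_range.1 hj)) (norm_nonneg _)
        _ = γ / r * ∑ j ∈ Finset.range n, ‖y j u‖ := (Finset.mul_sum _ _ _).symm
        _ ≤ γ / r * Y := by
            refine mul_le_mul_of_nonneg_left ?_ (by positivity)
            exact Finset.single_le_sum (f := fun u => ∑ j ∈ Finset.range n, ‖y j u‖)
              (fun _ _ => Finset.sum_nonneg fun _ _ => norm_nonneg _) hu
    rw [sub_apply]
    refine (norm_sub_le _ _).trans ?_
    have : 0 ≤ n * (γ / r * 2) := by positivity
    linarith
  · have h1 : (x - xp) - ∑ k ∈ Finset.range n, a k • y k - (x - xp) =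
        ∑ k ∈ Finset.range n, (-a k) • y k := by
      ext v
      simp [sum_apply]
    rw [h1]
    have h2 := hK.sum_mem_dilate (Finset.range n) (r := fun _ => γ / r * 2)
      (f := fun k => (-a k) • y k) (fun _ _ => by positivity) (fun k hk => by
        refine hK.smul_mem_dilate (by positivity) ?_ (hyK k (Finset.mem_range.1 hk))
        rw [norm_neg, abs_two]
        exact mul_le_mul_of_nonneg_right (han k (Finset.mem_range.1 hk)) zero_le_two)
    refine hK.dilate_mono ?_ ?_ h2
    · exact Finset.sum_nonneg fun _ _ => by positivity
    · rw [Finset.sum_const, Finset.card_range, nsmul_eq_mul]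
      have : 0 ≤ γ / r * Y := by positivity
      linarith

/-- The increments along a tree on `ℕ` whose parent function is `p`. -/
def treeIncr {E : Type*} [Sub E] (p : ℕ → ℕ) (z : ℕ → E) (n : ℕ) : E :=
  if n = 0 then z 0 else z n - z (p n)

theorem treeIncr_congr {E : Type*} [Sub E] {p : ℕ → ℕ} (hp : ∀ n ≠ 0, p n < n) {z z' : ℕ → E}
    {n : ℕ} (h : ∀ k ≤ n, z k = z' k) : treeIncr p z n = treeIncr p z' n := by
  unfold treeIncr
  split_ifs with h0
  · exact h 0 (Nat.zero_le n)
  · rw [h n le_rfl, h (p n) (hp n h0).le]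

/-- The data chosen at one stage of the construction: a point `x` of the given separated set, the
functional `z`, the vector `w`, and finite sets `G` and `S` that are norming for the spans of the
vectors and of the functionals chosen so far. -/
structure Stage (𝕜 W Z : Type*) [RCLike 𝕜] [NormedAddCommGroup W] [NormedSpace 𝕜 W]
    [NormedAddCommGroup Z] [NormedSpace 𝕜 Z] where
  x : StrongDual 𝕜 Z
  z : StrongDual 𝕜 Z
  w : W
  G : Finset (StrongDual 𝕜 W)
  S : Finset Z

/-- The requirements on the `n`-th stage, in terms of the stages before it. -/
structure Stage.IsGood (R : W →L[𝕜] Z) (K B : Set (StrongDual 𝕜 Z)) (p : ℕ → ℕ) (d : ℕ → Z)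
    (a r β η : ℝ) (n : ℕ) (f : ℕ → Stage 𝕜 W Z) : Prop where
  x_mem : (f n).x ∈ B
  sub_mem : (f n).z - (f n).x ∈ dilate 𝕜 K ((1 - a) * (1 - (1 / 2) ^ (n + 1)))
  norm_w : ‖(f n).w‖ = 1
  incr_old : ∀ k < n, treeIncr p (fun i => (f i).z) n (R (f k).w) = 0
  old_incr : ∀ k < n, treeIncr p (fun i => (f i).z) k (R (f n).w) = 0
  diag : ∃ c : ℝ, r < c ∧ treeIncr p (fun i => (f i).z) n (R (f n).w) = c
  G_zero : ∀ k < n, ∀ g ∈ (f k).G, g (f n).w = 0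
  S_small : ∀ k < n, ∀ u ∈ (f k).S, ‖treeIncr p (fun i => (f i).z) n u‖ ≤ β * (1 / 2) ^ n
  d_small : ∀ k < n, ‖treeIncr p (fun i => (f i).z) n (d k)‖ ≤ β * (1 / 2) ^ n
  G_norm : ∀ g ∈ (f n).G, ‖g‖ ≤ 1
  G_norming : ∀ v ∈ Submodule.span 𝕜 ((fun i => (f i).w) '' Set.Iic n),
    ∃ g ∈ (f n).G, ‖v‖ ≤ (1 + η) * ‖g v‖
  S_norm : ∀ u ∈ (f n).S, ‖u‖ ≤ 1
  S_norming : ∀ g ∈ Submodule.span 𝕜 (treeIncr p (fun i => (f i).z) '' Set.Iic n),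
    ∃ u ∈ (f n).S, ‖g‖ ≤ (1 + η) * ‖g u‖

/-- Parents precede their children, so the increments up to `n` involve no later stage. -/
theorem Stage.IsGood.congr {R : W →L[𝕜] Z} {K B : Set (StrongDual 𝕜 Z)} {p : ℕ → ℕ} {d : ℕ → Z}
    {a r β η : ℝ} (hp : ∀ n ≠ 0, p n < n) {n : ℕ} {f g : ℕ → Stage 𝕜 W Z}
    (hfg : ∀ k ≤ n, f k = g k) (h : Stage.IsGood R K B p d a r β η n f) :
    Stage.IsGood R K B p d a r β η n g := by
  have hy : ∀ k ≤ n, treeIncr p (fun i => (f i).z) k = treeIncr p (fun i => (g i).z) k :=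
    fun k hk => treeIncr_congr hp fun j hj => by rw [hfg j (hj.trans hk)]
  have hn := hfg n le_rfl
  have hyn := hy n le_rfl
  have hw : (fun i => (f i).w) '' Set.Iic n = (fun i => (g i).w) '' Set.Iic n :=
    Set.image_congr fun k hk => by rw [hfg k hk]
  have hys : treeIncr p (fun i => (f i).z) '' Set.Iic n =
      treeIncr p (fun i => (g i).z) '' Set.Iic n := Set.image_congr fun k hk => hy k hk
  obtain ⟨h1, h2, h3, h4, h5, h6, h7, h8, h9, h10, h11, h12, h13⟩ := h
  rw [hn] at h1 h2 h3 h10 h12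
  rw [hyn, hn] at h6
  rw [hw, hn] at h11
  rw [hys, hn] at h13
  refine ⟨h1, h2, h3, ?_, ?_, h6, ?_, ?_, ?_, h10, h11, h12, h13⟩
  · intro k hk
    rw [← hyn, ← hfg k hk.le]
    exact h4 k hk
  · intro k hk
    rw [← hy k hk.le, ← hn]
    exact h5 k hk
  · intro k hk
    rw [← hn, ← hfg k hk.le]
    exact h7 k hk
  · intro k hk
    rw [← hyn, ← hfg k hk.le]
    exact h8 k hk
  · intro k hk
    rw [← hyn]
    exact h9 k hk

theorem Stage.IsGood.z_mem {R : W →L[𝕜] Z} {K B : Set (StrongDual 𝕜 Z)} {p : ℕ → ℕ} {d : ℕ → Z}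
    {a r β η : ℝ} (hK : IsAbsConvexSet 𝕜 K) (ha : 0 ≤ a) (ha1 : a < 1)
    (hBK : B ⊆ dilate 𝕜 K a) {n : ℕ} {f : ℕ → Stage 𝕜 W Z} (h : Stage.IsGood R K B p d a r β η n f) : (f n).z ∈ K := by
  have hpow : ((1 : ℝ) / 2) ^ (n + 1) ≤ 1 := pow_le_one₀ (by norm_num) (by norm_num)
  have hpow0 : (0 : ℝ) < (1 / 2) ^ (n + 1) := by positivity
  exact hK.mem_of_sub_mem_dilate ha (mul_nonneg (by linarith) (by linarith)) (by nlinarith)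
    (hBK h.x_mem) h.sub_mem

/-- The extension step is applied at the parent's point; the norming sets are chosen afterwards,
because their spans must include the new vector and the new increment. -/
theorem exists_isGood_update (R : W →L[𝕜] Z) {K B : Set (StrongDual 𝕜 Z)}
    (hK : IsAbsConvexSet 𝕜 K) (hBne : B.Nonempty) {M ε r : ℝ}
    (hBM : ∀ x ∈ B, ‖x.comp R‖ ≤ M)
    (hsep : ∀ x ∈ B, ∀ y ∈ B, x ≠ y → ε < ‖x.comp R - y.comp R‖)
    (hnear : ∀ x ∈ B, ∀ (U : Finset Z) (γ : ℝ), 0 < γ →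
      {x' ∈ B | ∀ u ∈ U, ‖(x' - x) u‖ < γ}.Infinite)
    (hr : 0 < r) (hrε : 2 * r < ε) {a : ℝ} (ha : 0 ≤ a) (ha1 : a < 1) (hBK : B ⊆ dilate 𝕜 K a)
    {p : ℕ → ℕ} (hp : ∀ n ≠ 0, p n < n) (d : ℕ → Z) {β η : ℝ} (hβ : 0 < β) (hη : 0 < η) (n : ℕ)
    (f : ℕ → Stage 𝕜 W Z) (hf : ∀ k < n, Stage.IsGood R K B p d a r β η k f) :
    ∃ s, Stage.IsGood R K B p d a r β η n (Function.update f n s) := by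
  classical
  set y := treeIncr p (fun i => (f i).z) with hy
  have hzK : ∀ k < n, (f k).z ∈ K := fun k hk => (hf k hk).z_mem hK ha ha1 hBK
  have hK1 : ∀ z ∈ K, z ∈ dilate 𝕜 K 1 := fun z hz => by rwa [dilate_one]
  have hyK : ∀ k < n, y k ∈ dilate 𝕜 K 2 := by
    intro k hk
    by_cases h0 : k = 0
    · have : y k = (f 0).z := by simp [hy, treeIncr, h0]
      rw [this]
      exact hK.dilate_mono zero_le_one one_le_two (hK1 _ (hzK 0 (by omega)))
    · have : y k = (f k).z + (-(1 : 𝕜)) • (f (p k)).z := by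
        ext v
        simp [hy, treeIncr, h0, sub_eq_add_neg]
      rw [this, show (2 : ℝ) = 1 + 1 by norm_num]
      exact hK.add_mem_dilate zero_le_one zero_le_one (hK1 _ (hzK k hk))
        (hK.smul_mem_dilate zero_le_one (by simp) (hK1 _ (hzK (p k) ((hp k h0).trans hk))))
  have hyw : ∀ i < n, ∀ j < n, i ≠ j → y i (R (f j).w) = 0 := by
    intro i hi j hj hij
    rcases lt_or_gt_of_ne hij with h | h
    · exact (hf j hj).old_incr i h
    · exact (hf i hi).incr_old j h
  -- The root has no parent; the value `0` there makes the first increment `z 0` itself.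
  let xp : StrongDual 𝕜 Z := if n = 0 then 0 else (f (p n)).x
  let zp : StrongDual 𝕜 Z := if n = 0 then 0 else (f (p n)).z
  let F : Finset (StrongDual 𝕜 W) := (Finset.range n).biUnion fun k => (f k).G
  let U : Finset Z := ((Finset.range n).biUnion fun k => (f k).S) ∪ (Finset.range n).image d
  have hxp : xp ∈ B ∨ n = 0 ∧ U = ∅ := by
    by_cases h0 : n = 0
    · exact Or.inr ⟨h0, by simp [U, h0]⟩
    · left
      simp only [xp, h0, if_false]
      exact (hf (p n) (hp n h0)).x_mem
  -- The first bound gives smallness on `U`; the second raises the error budget from `1 - (1 / 2) ^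
  -- n` to `1 - (1 / 2) ^ (n + 1)`, in units of `1 - a`.
  let κ : ℝ := min (β * (1 / 2) ^ n) ((1 - a) * (1 / 2) ^ (n + 1))
  have hκ : 0 < κ := lt_min (by positivity) (mul_pos (by linarith) (by positivity))
  obtain ⟨x, hxB, y', w', hw1, hwF, hy'w, hyw', hdiag, hsmall, hclose⟩ :=
    exists_biorthogonal_extension R hK hBne hBM hsep hnear hr hrε (w := fun k => (f k).w)
      hyw (fun i hi => (hf i hi).diag) hyK xp F U hxp hκ
  let w₁ : ℕ → W := Function.update (fun i => (f i).w) n w'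
  let z₁ : ℕ → StrongDual 𝕜 Z := Function.update (fun i => (f i).z) n (zp + y')
  have hfin1 : FiniteDimensional 𝕜 (Submodule.span 𝕜 (w₁ '' Set.Iic n)) :=
    FiniteDimensional.span_of_finite 𝕜 ((Set.finite_Iic n).image _)
  have hfin2 : FiniteDimensional 𝕜 (Submodule.span 𝕜 (treeIncr p z₁ '' Set.Iic n)) :=
    FiniteDimensional.span_of_finite 𝕜 ((Set.finite_Iic n).image _)
  obtain ⟨G, hG1, hG2⟩ := exists_finset_dual_norming (Submodule.span 𝕜 (w₁ '' Set.Iic n)) hη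
  obtain ⟨S, hS1, hS2⟩ :=
    exists_finset_predual_norming (Submodule.span 𝕜 (treeIncr p z₁ '' Set.Iic n)) hη
  refine ⟨⟨x, zp + y', w', G, S⟩, ?_⟩
  set f' := Function.update f n ⟨x, zp + y', w', G, S⟩ with hf'
  have hfn : f' n = ⟨x, zp + y', w', G, S⟩ := Function.update_self _ _ _
  have hfk : ∀ k < n, f' k = f k := fun k hk => Function.update_of_ne hk.ne _ _
  have hw₁ : (fun i => (f' i).w) = w₁ := by
    funext i
    by_cases hi : i = n
    · subst hi
      simp [hfn, w₁]
    · simp [hf', w₁, hi]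
  have hz₁ : (fun i => (f' i).z) = z₁ := by
    funext i
    by_cases hi : i = n
    · subst hi
      simp [hfn, z₁]
    · simp [hf', z₁, hi]
  have hyk : ∀ k < n, treeIncr p z₁ k = y k := fun k hk => treeIncr_congr hp fun j hj =>
    Function.update_of_ne (by omega) _ _
  have hyn : treeIncr p z₁ n = y' := by
    by_cases h0 : n = 0
    · subst h0
      simp [treeIncr, z₁, zp]
    · have h1 : z₁ (p n) = zp := by
        simp only [z₁, zp, h0, if_false]
        exact Function.update_of_ne (hp n h0).ne _ _
      simp only [treeIncr, h0, if_false]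
      rw [h1]
      simp [z₁]
  have hsub : zp - xp ∈ dilate 𝕜 K ((1 - a) * (1 - (1 / 2) ^ n)) := by
    by_cases h0 : n = 0
    · simp only [zp, xp, h0, if_true, sub_self]
      exact hK.zero_mem_dilate _
    · simp only [zp, xp, h0, if_false]
      have hpn := hp n h0
      refine hK.dilate_mono ?_ ?_ (hf (p n) hpn).sub_mem
      · exact mul_nonneg (by linarith)
          (sub_nonneg.2 (pow_le_one₀ (by norm_num) (by norm_num)))
      · refine mul_le_mul_of_nonneg_left (sub_le_sub_left ?_ 1) (by linarith)
        exact pow_le_pow_of_le_one (by norm_num) (by norm_num) hpn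
  have hκ1 : κ ≤ β * (1 / 2) ^ n := min_le_left _ _
  have hκ2 : κ ≤ (1 - a) * (1 / 2) ^ (n + 1) := min_le_right _ _
  refine ⟨?_, ?_, ?_, ?_, ?_, ?_, ?_, ?_, ?_, ?_, ?_, ?_, ?_⟩
  · rw [hfn]
    exact hxB
  · rw [hfn]
    have h1 : zp + y' - x = (zp - xp) + (y' - (x - xp)) := by abel
    have h2 := hK.add_mem_dilate (mul_nonneg (by linarith)
      (sub_nonneg.2 (pow_le_one₀ (by norm_num) (by norm_num)))) hκ.le hsub hclose
    simp only
    rw [h1]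
    refine hK.dilate_mono (add_nonneg (mul_nonneg (by linarith)
      (sub_nonneg.2 (pow_le_one₀ (by norm_num) (by norm_num)))) hκ.le) ?_ h2
    have h3 : ((1 : ℝ) / 2) ^ n = 2 * (1 / 2) ^ (n + 1) := by ring
    rw [h3]
    linarith
  · rw [hfn]
    exact hw1
  · intro k hk
    rw [hz₁, hyn, hfk k hk]
    exact hy'w k hk
  · intro k hk
    rw [hz₁, hyk k hk, hfn]
    exact hyw' k hk
  · rw [hz₁, hyn, hfn]
    exact hdiag
  · intro k hk g hg
    rw [hfk k hk] at hg
    rw [hfn]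
    exact hwF g (Finset.mem_biUnion.2 ⟨k, Finset.mem_range.2 hk, hg⟩)
  · intro k hk u hu
    rw [hfk k hk] at hu
    rw [hz₁, hyn]
    exact (hsmall u (Finset.mem_union_left _
      (Finset.mem_biUnion.2 ⟨k, Finset.mem_range.2 hk, hu⟩))).trans hκ1
  · intro k hk
    rw [hz₁, hyn]
    exact (hsmall _ (Finset.mem_union_right _
      (Finset.mem_image_of_mem _ (Finset.mem_range.2 hk)))).trans hκ1
  · rw [hfn]
    exact hG1
  · rw [hw₁, hfn]
    exact hG2
  · rw [hfn]
    exact hS1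
  · rw [hz₁, hfn]
    exact hS2

end Construction

/-! ### Parents, wedges and branches -/

section Tree

variable {T : Set (List ℕ)}

/-- The parent is obtained by dropping the last entry; only index `0` can carry the empty sequence.
-/
theorem IsDownClosed.exists_parent (hT : IsDownClosed T) (τ : ℕ ≃ T)
    (hτ : ∀ l m : ℕ, (τ l : List ℕ) <+: (τ m : List ℕ) → l ≤ m) :
    ∃ p : ℕ → ℕ, ∀ n ≠ 0, p n < n ∧ ∀ j, (τ j : List ℕ) <+: (τ n : List ℕ) ↔
      j = n ∨ (τ j : List ℕ) <+: (τ (p n) : List ℕ) := by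
  have hmem : ∀ n, (τ n : List ℕ).dropLast ∈ T := fun n =>
    hT _ (τ n).2 _ (List.dropLast_prefix _)
  refine ⟨fun n => τ.symm ⟨_, hmem n⟩, fun n hn => ?_⟩
  have hne : (τ n : List ℕ) ≠ [] := by
    intro h0
    refine hn (Nat.le_zero.1 (hτ n 0 ?_))
    rw [h0]
    exact List.nil_prefix
  have hval : (τ (τ.symm ⟨_, hmem n⟩) : List ℕ) = (τ n : List ℕ).dropLast := by simp
  refine ⟨lt_of_le_of_ne (hτ _ _ ?_) ?_, fun j => ?_⟩
  · rw [hval]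
    exact List.dropLast_prefix _
  · intro h
    simp only at h
    rw [h] at hval
    have h1 := congrArg List.length hval
    rw [List.length_dropLast] at h1
    have h2 := List.length_pos_iff.2 hne
    omega
  · rw [hval]
    conv_lhs => rw [← List.dropLast_append_getLast hne]
    rw [List.prefix_concat_iff, List.dropLast_append_getLast hne]
    refine or_congr ⟨fun h => τ.injective (Subtype.ext h), fun h => by rw [h]⟩ Iff.rfl

theorem TreeBar.node_le_node {s t : T} :
    TreeBar.node s ≤ TreeBar.node t ↔ (s : List ℕ) <+: (t : List ℕ) := Iff.rfl

theorem TreeBar.node_le_branch {s : T} {b : {b : Set (List ℕ) // IsInfiniteBranch T b}} :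
    TreeBar.node s ≤ TreeBar.branch b ↔ (s : List ℕ) ∈ (b : Set (List ℕ)) := Iff.rfl

/-- The strict predecessors of a node are proper initial segments: there are none, or `dropLast` is
the greatest. Hence the wedge and its complement are both subbasic. -/
theorem TreeBar.isClopen_Ici_node (hT : IsDownClosed T) (s : T) :
    IsClopen (Set.Ici (TreeBar.node s)) := by
  have key : Set.Iio (TreeBar.node s) = ∅ ∨ ∃ m, IsGreatest (Set.Iio (TreeBar.node s)) m := by
    have hlt : ∀ t : TreeBar T, t < TreeBar.node s → ∃ u : T, t = TreeBar.node u ∧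
        (u : List ℕ) <+: (s : List ℕ) ∧ (u : List ℕ) ≠ s := by
      intro t ht
      cases t with
      | node u =>
        refine ⟨u, rfl, ht.le, fun h => ht.ne ?_⟩
        rw [Subtype.ext h]
      | branch b => exact ht.le.elim
    by_cases hs : (s : List ℕ) = []
    · left
      rw [Set.eq_empty_iff_forall_notMem]
      intro t ht
      obtain ⟨u, -, hu, hne⟩ := hlt t ht
      rw [hs] at hu hne
      exact hne (List.prefix_nil.1 hu)
    · right
      refine ⟨TreeBar.node ⟨_, hT _ s.2 _ (List.dropLast_prefix _)⟩, ?_, ?_⟩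
      · refine lt_of_le_of_ne (TreeBar.node_le_node.2 (List.dropLast_prefix _)) fun h => ?_
        injection h with h
        have h1 := congrArg (fun u : T => (u : List ℕ).length) h
        simp only [List.length_dropLast] at h1
        have h2 := List.length_pos_iff.2 hs
        omega
      · intro t ht
        obtain ⟨u, rfl, hu, hne⟩ := hlt t ht
        rw [← List.dropLast_append_getLast hs, List.prefix_concat_iff] at hu
        rcases hu with hu | hu
        · rw [List.dropLast_append_getLast hs] at hu
          exact absurd hu hne
        · exact hu
  constructor
  · rw [← isOpen_compl_iff]
    exact TopologicalSpace.isOpen_generateFrom_of_mem ⟨_, key, Or.inr rfl⟩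
  · exact TopologicalSpace.isOpen_generateFrom_of_mem ⟨_, key, Or.inl rfl⟩

/-- The filter on the indices of the nodes of a branch, tending to the branch. -/
def branchFilter (τ : ℕ ≃ T) (b : Set (List ℕ)) : Filter ℕ :=
  atTop ⊓ 𝓟 {k | (τ k : List ℕ) ∈ b}

theorem branchFilter_neBot (τ : ℕ ≃ T) {b : Set (List ℕ)} (hb : IsInfiniteBranch T b) :
    (branchFilter τ b).NeBot := by
  have hinf : {k | (τ k : List ℕ) ∈ b}.Infinite := by
    intro hfin
    refine hb.1 ((hfin.image fun k => (τ k : List ℕ)).subset fun s hs => ?_)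
    exact ⟨τ.symm ⟨s, hb.2.prop.1 hs⟩, by simpa using hs, by simp⟩
  rw [branchFilter, ← Filter.frequently_mem_iff_neBot]
  exact Nat.frequently_atTop_iff_infinite.2 hinf

/-- Two nodes of a branch are comparable, and for `k ≥ j` the enumeration order decides which is
smaller. -/
theorem eventually_branchFilter_prefix_iff (τ : ℕ ≃ T)
    (hτ : ∀ l m : ℕ, (τ l : List ℕ) <+: (τ m : List ℕ) → l ≤ m) {b : Set (List ℕ)}
    (hb : IsInfiniteBranch T b) (j : ℕ) :
    ∀ᶠ k in branchFilter τ b, ((τ j : List ℕ) <+: (τ k : List ℕ) ↔ (τ j : List ℕ) ∈ b) := by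
  rw [branchFilter, eventually_inf_principal]
  filter_upwards [eventually_ge_atTop j] with k hjk hk
  refine ⟨fun h => TreeBar.mem_branch_of_prefix hb (τ j).2 h hk, fun hj => ?_⟩
  rcases hb.2.prop.2.total hj hk with h | h
  · exact h
  · rw [le_antisymm hjk (hτ k j h)]

end Tree

/-! ### Summing increments along nodes and branches -/

section TreeSum

variable {𝕜 : Type*} [RCLike 𝕜] {Z : Type*} [NormedAddCommGroup Z] [NormedSpace 𝕜 Z]
  {T : Set (List ℕ)}

/-- A finite telescoping sum over ancestors, indexed by all of `ℕ` so that it can pass to the limit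
along a branch. -/
theorem hasSum_treeIncr {τ : ℕ ≃ T} (hτ : ∀ l m : ℕ, (τ l : List ℕ) <+: (τ m : List ℕ) → l ≤ m)
    {p : ℕ → ℕ} (hp : ∀ n ≠ 0, p n < n ∧ ∀ j, (τ j : List ℕ) <+: (τ n : List ℕ) ↔
      j = n ∨ (τ j : List ℕ) <+: (τ (p n) : List ℕ)) (z : ℕ → StrongDual 𝕜 Z) (v : Z) (n : ℕ) :
    HasSum (fun j => if (τ j : List ℕ) <+: (τ n : List ℕ) then treeIncr p z j v else 0)
      (z n v) := by
  induction n using Nat.strong_induction_on with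
  | _ n ih =>
    by_cases h0 : n = 0
    · subst h0
      have h1 : ∀ j, (τ j : List ℕ) <+: (τ 0 : List ℕ) ↔ j = 0 := fun j =>
        ⟨fun h => Nat.le_zero.1 (hτ j 0 h), fun h => by rw [h]⟩
      simp only [h1]
      convert hasSum_ite_eq 0 (z 0 v) using 2 with j
      split_ifs with hj
      · subst hj
        simp [treeIncr]
      · rfl
    · obtain ⟨hlt, hpre⟩ := hp n h0
      have h1 := (ih (p n) hlt).add (hasSum_ite_eq n (treeIncr p z n v))
      have h2 : z (p n) v + treeIncr p z n v = z n v := by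
        simp [treeIncr, h0]
      rw [h2] at h1
      refine h1.congr_fun fun j => ?_
      by_cases hj : j = n
      · subst hj
        have h3 : ¬ (τ j : List ℕ) <+: (τ (p j) : List ℕ) := fun h =>
          absurd (hτ _ _ h) (not_le.2 hlt)
        simp [h3]
      · simp [hpre j, hj]

/-- A weak* cluster point of functionals from a weak* compact set takes the limit values wherever
the limit exists. -/
theorem exists_mem_forall_tendsto_eq {K : Set (StrongDual 𝕜 Z)}
    (hK : IsCompact (StrongDual.toWeakDual '' K)) {ι : Type*} {z : ι → StrongDual 𝕜 Z}
    (hz : ∀ k, z k ∈ K) (L : Filter ι) [L.NeBot] :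
    ∃ f ∈ K, ∀ v l, Tendsto (fun k => z k v) L (𝓝 l) → f v = l := by
  let U : Ultrafilter ι := Ultrafilter.of L
  obtain ⟨_, ⟨f, hf, rfl⟩, hlim⟩ := hK.ultrafilter_le_nhds
    (U.map fun k => StrongDual.toWeakDual (z k)) (by
      rw [le_principal_iff]
      exact Filter.Eventually.of_forall (f := (U : Filter ι)) fun k => ⟨z k, hz k, rfl⟩)
  refine ⟨f, hf, fun v l hl => ?_⟩
  have h1 : Tendsto (fun k => z k v) U (𝓝 (f v)) :=
    ((WeakDual.eval_continuous v).tendsto (StrongDual.toWeakDual f)).comp hlim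
  exact tendsto_nhds_unique h1 (hl.mono_left (Ultrafilter.of_le L))

open scoped Classical in
/-- Extension of a family of functionals from the nodes of a tree to its branches. -/
theorem exists_treeBar_extension (hT : IsDownClosed T) {τ : ℕ ≃ T}
    (hτ : ∀ l m : ℕ, (τ l : List ℕ) <+: (τ m : List ℕ) → l ≤ m)
    {p : ℕ → ℕ} (hp : ∀ n ≠ 0, p n < n ∧ ∀ j, (τ j : List ℕ) <+: (τ n : List ℕ) ↔
      j = n ∨ (τ j : List ℕ) <+: (τ (p n) : List ℕ))
    {K : Set (StrongDual 𝕜 Z)} (hK : IsCompact (StrongDual.toWeakDual '' K)) {M : ℝ}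
    (hM : ∀ f ∈ K, ‖f‖ ≤ M) {z : ℕ → StrongDual 𝕜 Z} (hz : ∀ k, z k ∈ K)
    {D : Set Z} (hD : Dense D)
    (hDz : ∀ d ∈ D, Summable fun j => ‖treeIncr p z j d‖) :
    ∃ Φ : TreeBar T → StrongDual 𝕜 Z, (∀ t, Φ t ∈ K) ∧ (∀ n, Φ (TreeBar.node (τ n)) = z n) ∧
      Continuous (fun t => StrongDual.toWeakDual (Φ t)) ∧
      ∀ v, (Summable fun j => ‖treeIncr p z j v‖) → ∀ t,
        Φ t v = ∑' j, if TreeBar.node (τ j) ≤ t then treeIncr p z j v else 0 := by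
  have hbr : ∀ b : {b : Set (List ℕ) // IsInfiniteBranch T b}, ∃ f ∈ K, ∀ v l,
      Tendsto (fun k => z k v) (branchFilter τ b) (𝓝 l) → f v = l := fun b =>
    haveI := branchFilter_neBot τ b.2
    exists_mem_forall_tendsto_eq hK hz _
  choose φ hφK hφ using hbr
  let Φ : TreeBar T → StrongDual 𝕜 Z := fun t => match t with
    | TreeBar.node s => z (τ.symm s)
    | TreeBar.branch b => φ b
  have hΦK : ∀ t, Φ t ∈ K := by
    intro t
    cases t with
    | node s => exact hz _
    | branch b => exact hφK b
  have hΦv : ∀ v, (Summable fun j => ‖treeIncr p z j v‖) → ∀ t,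
      Φ t v = ∑' j, if TreeBar.node (τ j) ≤ t then treeIncr p z j v else 0 := by
    intro v hv t
    cases t with
    | node s =>
      obtain ⟨n, rfl⟩ := τ.surjective s
      have h1 : Φ (TreeBar.node (τ n)) = z n := by simp [Φ]
      rw [h1]
      rw [← (hasSum_treeIncr hτ hp z v n).tsum_eq]
      simp only [TreeBar.node_le_node]
    | branch b =>
      refine hφ b v _ ?_
      have h1 : (fun k => z k v) = fun k => ∑' j,
          if (τ j : List ℕ) <+: (τ k : List ℕ) then treeIncr p z j v else 0 :=
        funext fun k => (hasSum_treeIncr hτ hp z v k).tsum_eq.symm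
      rw [h1]
      -- Along the branch each summand is eventually constant, and the whole series is dominated by
      -- the increments.
      refine tendsto_tsum_of_dominated_convergence hv (fun j => ?_)
        (Eventually.of_forall fun k j => ?_)
      · refine tendsto_const_nhds.congr' ?_
        filter_upwards [eventually_branchFilter_prefix_iff τ hτ b.2 j] with k hk
        simp only [hk, TreeBar.node_le_branch]
      · split_ifs
        · exact le_rfl
        · simp
  refine ⟨Φ, hΦK, fun n => by simp [Φ], ?_, hΦv⟩
  refine WeakDual.continuous_of_continuous_eval fun v => ?_
  have hcontD : ∀ d ∈ D, Continuous fun t => Φ t d := by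
    intro d hd
    simp only [hΦv d (hDz d hd)]
    refine continuous_tsum (fun j => ?_) (hDz d hd) fun j t => ?_
    · refine Continuous.if (fun t ht => ?_) continuous_const continuous_const
      have h1 := (TreeBar.isClopen_Ici_node hT (τ j)).frontier_eq
      change t ∈ frontier (Set.Ici (TreeBar.node (τ j))) at ht
      rw [h1] at ht
      exact ht.elim
    · split_ifs
      · exact le_rfl
      · simp
  -- The functionals are uniformly bounded, so approximating `v` by `d ∈ D` approximates the
  -- evaluation uniformly in `t`.
  refine continuous_of_uniform_approx_of_continuous fun u hu => ?_
  obtain ⟨r, hr, hru⟩ := Metric.mem_uniformity_dist.1 hu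
  obtain ⟨d, hdball, hd⟩ := Metric.dense_iff.1 hD v (r / (|M| + 1)) (by positivity)
  refine ⟨fun t => Φ t d, hcontD d hd, fun t => hru ?_⟩
  have h1 : ‖v - d‖ < r / (|M| + 1) := by rwa [← dist_eq_norm, dist_comm]
  rw [lt_div_iff₀ (by positivity)] at h1
  have h2 : ‖Φ t‖ ≤ |M| := (hM _ (hΦK t)).trans (le_abs_self M)
  have h3 : (Φ t) v - (Φ t) d = Φ t (v - d) := (map_sub _ _ _).symm
  change dist (Φ t v) (Φ t d) < r
  rw [dist_eq_norm, h3]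
  refine ((Φ t).le_opNorm _).trans_lt ?_
  nlinarith [norm_nonneg (v - d), norm_nonneg (Φ t)]

end TreeSum

/-! ### The separated set and the main theorem -/

section Main

variable {𝕜 : Type*} [RCLike 𝕜]

theorem IsBasisWithConstLE.mono {X : Type*} [NormedAddCommGroup X] [NormedSpace 𝕜 X] {x : ℕ → X}
    {C C' : ℝ} (h : IsBasisWithConstLE 𝕜 x C) (hC : C ≤ C') : IsBasisWithConstLE 𝕜 x C' := by
  obtain ⟨b, hb, hbC⟩ := h
  exact ⟨b, hb, hbC.trans (ENNReal.ofReal_le_ofReal hC)⟩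

variable {W : Type*} [NormedAddCommGroup W] [NormedSpace 𝕜 W]
  {Z : Type*} [NormedAddCommGroup Z] [NormedSpace 𝕜 Z]

/-- A weak* dense-in-itself set of functionals, taken from a dilate of `K`, whose image under the
adjoint of `R` is separated. -/
theorem exists_separated_denseInItself [TopologicalSpace.SeparableSpace Z] (R : W →L[𝕜] Z)
    {K : Set (StrongDual 𝕜 Z)} (hKabs : IsAbsConvexSet 𝕜 K)
    (hKcomp : IsCompact (StrongDual.toWeakDual '' K)) {ε : ℝ}
    (hKsep : ∃ A ⊆ (fun f : StrongDual 𝕜 Z => f.comp R) '' K,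
      ¬ A.Countable ∧ Metric.IsSeparated (ENNReal.ofReal ε) A) {a : ℝ} (ha : 0 < a) (ha1 : a ≤ 1) :
    ∃ B ⊆ dilate 𝕜 K a, B.Nonempty ∧
      (∀ x ∈ B, ∀ y ∈ B, x ≠ y → a * ε < ‖x.comp R - y.comp R‖) ∧
      ∀ x ∈ B, ∀ (U : Finset Z) (γ : ℝ), 0 < γ →
        {x' ∈ B | ∀ u ∈ U, ‖(x' - x) u‖ < γ}.Infinite := by
  obtain ⟨A, hAK, hA, hsep⟩ := hKsep
  -- One preimage is kept for each point of `A`, so distinct points of `S` have separated images.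
  obtain ⟨S, hSK, hS⟩ := Set.SurjOn.exists_bijOn_subset
    (f := fun f : StrongDual 𝕜 Z => f.comp R) (s := K) (t := A) hAK
  have hSc : ¬ S.Countable := fun h => hA (hS.image_eq ▸ h.image _)
  have ha0 : (a : 𝕜) ≠ 0 := by exact_mod_cast ha.ne'
  let m : StrongDual 𝕜 Z → StrongDual 𝕜 Z := fun f => (a : 𝕜) • f
  have hm : Function.Injective m := fun f g hfg => by
    ext v
    have h1 := DFunLike.congr_fun hfg v
    simpa [m, ha0] using h1
  have hmSd : m '' S ⊆ dilate 𝕜 K a := by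
    rintro _ ⟨f, hf, rfl⟩
    exact ⟨f, hSK hf, rfl⟩
  have hmSK : m '' S ⊆ K := fun f hf => by
    have h1 := hKabs.dilate_mono ha.le ha1 (hmSd hf)
    rwa [dilate_one] at h1
  have hmSc : ¬ (m '' S).Countable := fun h =>
    hSc (Set.countable_of_injective_of_countable_image hm.injOn h)
  obtain ⟨B, hBS, hBne, hB⟩ := exists_subset_forall_infinite_near hKcomp hmSK hmSc
  refine ⟨B, hBS.trans hmSd, hBne, fun x hx y hy hxy => ?_, hB⟩
  obtain ⟨f, hf, rfl⟩ := hBS hx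
  obtain ⟨g, hg, rfl⟩ := hBS hy
  have hfg : f ≠ g := fun h => hxy (by rw [h])
  have h1 := hsep (hS.mapsTo hf) (hS.mapsTo hg) (hS.injOn.ne hf hg hfg)
  change ENNReal.ofReal ε < edist (f.comp R) (g.comp R) at h1
  rw [edist_dist, ENNReal.ofReal_lt_ofReal_iff', dist_eq_norm] at h1
  have h2 : (m f).comp R - (m g).comp R = (a : 𝕜) • (f.comp R - g.comp R) := by
    ext v
    simp [m, mul_sub]
  rw [h2, norm_smul, RCLike.norm_ofReal, abs_of_pos ha]
  exact mul_lt_mul_of_pos_left h1.1 ha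

end Main

theorem mainTheorem1 {𝕜 : Type*} [RCLike 𝕜]
    {W : Type*} [NormedAddCommGroup W] [NormedSpace 𝕜 W] [CompleteSpace W]
    {Z : Type*} [NormedAddCommGroup Z] [NormedSpace 𝕜 Z] [CompleteSpace Z]
    [TopologicalSpace.SeparableSpace Z]
    (R : W →L[𝕜] Z) (K : Set (StrongDual 𝕜 Z)) (ε : ℝ) (hε : 0 < ε)
    (hKconv : AbsConvex 𝕜 K)
    (hKcomp : IsCompact (StrongDual.toWeakDual '' K))
    (hKsep : ∃ A ⊆ (fun f : StrongDual 𝕜 Z => f.comp R) '' K,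
      ¬ A.Countable ∧ Metric.IsSeparated (ENNReal.ofReal ε) A)
    (δ : ℝ) (hδ : 0 < δ) (θ : ℝ) (hθ : 0 < θ)
    (T : Set (List ℕ)) (hT : IsDownClosed T)
    (τ : ℕ ≃ T) (hτ : ∀ l m : ℕ, (τ l : List ℕ) <+: (τ m : List ℕ) → l ≤ m) :
    ∃ (w : T → W) (z : TreeBar T → StrongDual 𝕜 Z),
      (∀ t, ‖w t‖ = 1) ∧ (∀ t, z t ∈ K) ∧
      -- the strict inequality in `𝕜` says that the right-hand side is real and exceeds `ε / (2 + θ)`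
      (∀ (s : T) (t : TreeBar T),
        (TreeBar.node s ≤ t →
          z t (R (w s)) = z (TreeBar.node s) (R (w s)) ∧
          ((ε / (2 + θ) : ℝ) : 𝕜) < z (TreeBar.node s) (R (w s))) ∧
        (¬ TreeBar.node s ≤ t → z t (R (w s)) = 0)) ∧
      Continuous (fun t => StrongDual.toWeakDual (z t)) ∧
      IsBasicWithConstLE 𝕜 (fun m => w (τ m)) (1 + δ) ∧
      IsBasisWithConstLE 𝕜
        (fun m => (commonKer fun t : T => z (TreeBar.node t)).mkQ (R (w (τ m)))) (1 + δ) := by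
  classical
  have hKne : K.Nonempty := by
    obtain ⟨A, hAK, hA, -⟩ := hKsep
    by_contra h
    rw [Set.not_nonempty_iff_eq_empty] at h
    rw [h, Set.image_empty, Set.subset_empty_iff] at hAK
    exact hA (hAK ▸ Set.countable_empty)
  have hKabs := hKconv.isAbsConvexSet hKne
  obtain ⟨M, hM⟩ := exists_norm_le_of_isCompact_toWeakDual hKcomp
  set r : ℝ := ε / (2 + θ) with hr_def
  have hr : 0 < r := by positivity
  obtain ⟨a, ha2, ha1⟩ := exists_between (show 2 / (2 + θ) < 1 by
    rw [div_lt_one (by positivity)]; linarith)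
  have ha : 0 < a := lt_trans (by positivity) ha2
  have hra : 2 * r < a * ε := by
    have : 2 * r = 2 / (2 + θ) * ε := by rw [hr_def]; ring
    rw [this]
    exact mul_lt_mul_of_pos_right ha2 hε
  obtain ⟨B, hBd, hBne, hBsep, hBnear⟩ :=
    exists_separated_denseInItself R hKabs hKcomp hKsep ha ha1.le
  have hBK : B ⊆ K := fun x hx => by
    have h1 := hKabs.dilate_mono ha.le ha1.le (hBd hx)
    rwa [dilate_one] at h1
  have hBM : ∀ x ∈ B, ‖x.comp R‖ ≤ M * ‖R‖ := fun x hx =>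
    (x.opNorm_comp_le R).trans (mul_le_mul_of_nonneg_right (hM x (hBK hx)) (norm_nonneg _))
  obtain ⟨p, hp⟩ := hT.exists_parent τ hτ
  have hp' : ∀ n ≠ 0, p n < n := fun n hn => (hp n hn).1
  -- One factor `1 + η` comes from almost norming; in the quotient a second one bounds `1 + 2 * ‖R‖
  -- * β`.
  set η : ℝ := √(1 + δ) - 1 with hη_def
  have hη2 : (1 + η) * (1 + η) = 1 + δ := by
    rw [hη_def, add_sub_cancel]
    exact Real.mul_self_sqrt (by linarith)
  have hη : 0 < η := by
    have : 1 < √(1 + δ) := Real.lt_sqrt_of_sq_lt (by linarith)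
    linarith
  set β : ℝ := η / (2 * (‖R‖ + 1)) with hβ_def
  have hβ : 0 < β := by positivity
  have hβη : 2 * ‖R‖ * β ≤ η := by
    rw [hβ_def, mul_div_assoc', div_le_iff₀ (by positivity)]
    nlinarith
  have : Nonempty (Stage 𝕜 W Z) := ⟨⟨0, 0, 0, ∅, ∅⟩⟩
  obtain ⟨f, hf⟩ := exists_seq_of_forall_exists_update
    -- The factor `r` compensates for later dividing `y n` by its diagonal value `c n > r`.
    (Stage.IsGood R K B p (TopologicalSpace.denseSeq Z) a r (β * r) η)
    (fun n f g hfg h => h.congr hp' hfg)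
    (exists_isGood_update R hKabs hBne hBM hBsep hBnear hr hra ha.le ha1 hBd hp'
      (TopologicalSpace.denseSeq Z) (mul_pos hβ hr) hη)
  set z : ℕ → StrongDual 𝕜 Z := fun n => (f n).z with hz_def
  set w : ℕ → W := fun n => (f n).w with hw_def
  set y : ℕ → StrongDual 𝕜 Z := treeIncr p z with hy_def
  have hzK : ∀ n, z n ∈ K := fun n => (hf n).z_mem hKabs ha.le ha1 hBd
  have hyw : ∀ i j, i ≠ j → y i (R (w j)) = 0 := by
    intro i j hij
    rcases lt_or_gt_of_ne hij with h | h
    · exact (hf j).old_incr i h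
    · exact (hf i).incr_old j h
  choose c hrc hyc using fun n => (hf n).diag
  change ∀ n, y n (R (w n)) = c n at hyc
  have hc0 : ∀ n, (c n : 𝕜) ≠ 0 := fun n => by exact_mod_cast (hr.trans (hrc n)).ne'
  have hsumD : ∀ d ∈ Set.range (TopologicalSpace.denseSeq Z), Summable fun j => ‖y j d‖ := by
    rintro _ ⟨i, rfl⟩
    refine Summable.of_norm_bounded_eventually_nat (summable_geometric_two.mul_left (β * r)) ?_
    filter_upwards [eventually_gt_atTop i] with j hj
    rw [norm_norm]
    exact (hf j).d_small i hj
  obtain ⟨Φ, hΦK, hΦn, hΦc, hΦs⟩ := exists_treeBar_extension hT hτ hp hKcomp hM hzK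
    (TopologicalSpace.denseRange_denseSeq Z) hsumD
  -- By biorthogonality only the `n`-th increment contributes at `R (w n)`, so the series formula
  -- holds there also on branches.
  have hΦw : ∀ n t, Φ t (R (w n)) = if TreeBar.node (τ n) ≤ t then (c n : 𝕜) else 0 := by
    intro n t
    rw [hΦs (R (w n)) (summable_of_ne_finset_zero (s := {n}) fun j hj => by
      have hjn : j ≠ n := by simpa using hj
      simpa using hyw j n hjn) t, tsum_eq_single n]
    · change (if TreeBar.node (τ n) ≤ t then y n (R (w n)) else 0) = _
      rw [hyc]
    · intro j hj
      change (if TreeBar.node (τ j) ≤ t then y j (R (w n)) else 0) = _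
      rw [hyw j n hj, ite_self]
  have hcn : ∀ n, ‖((c n : 𝕜))⁻¹‖ ≤ 1 / r := fun n => by
    rw [norm_inv, RCLike.norm_ofReal, abs_of_pos (hr.trans (hrc n)), ← one_div]
    exact one_div_le_one_div_of_le hr (hrc n).le
  have hscale : ∀ n v, ‖y n v‖ ≤ β * r * (1 / 2) ^ n →
      ‖((c n : 𝕜)⁻¹ • y n) v‖ ≤ β * (1 / 2) ^ n := by
    intro n v h
    rw [smul_apply, norm_smul]
    calc _ ≤ 1 / r * (β * r * (1 / 2) ^ n) :=
          mul_le_mul (hcn n) h (norm_nonneg _) (by positivity)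
      _ = β * (1 / 2) ^ n := by field_simp
  have hbi : ∀ i j, ((c i : 𝕜)⁻¹ • y i) (R (w j)) = if i = j then 1 else 0 := by
    intro i j
    rw [smul_apply, smul_eq_mul]
    split_ifs with h
    · subst h
      rw [hyc, inv_mul_cancel₀ (hc0 i)]
    · rw [hyw i j h, mul_zero]
  have hIio : ∀ n, Set.Iio (n + 1) = Set.Iic n := fun n => by
    ext k
    simp
  refine ⟨fun t => w (τ.symm t), Φ, fun t => (hf _).norm_w, hΦK, fun s t => ?_, hΦc, ?_, ?_⟩
  · obtain ⟨n, rfl⟩ := τ.surjective s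
    simp only [Equiv.symm_apply_apply, hΦw, le_refl, if_true]
    refine ⟨fun h => ⟨by rw [if_pos h], ?_⟩, fun h => by rw [if_neg h]⟩
    exact RCLike.ofReal_lt_ofReal.2 (hrc n)
  · simp only [Equiv.symm_apply_apply]
    refine IsBasisWithConstLE.mono (isBasicWithConstLE_of_norming
      (f := fun i => ((c i : 𝕜)⁻¹ • y i).comp R) (C := 1 + η) hbi (by positivity) ?_)
      (by nlinarith)
    intro n v hv
    cases n with
    | zero =>
      refine ⟨0, by simp, ?_, fun _ _ => rfl⟩
      have : v = 0 := by simpa using hv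
      simp [this]
    | succ n =>
      rw [hIio] at hv
      obtain ⟨g, hg, hgv⟩ := (hf n).G_norming v hv
      exact ⟨g, (hf n).G_norm g hg, hgv, fun j hj => (hf j).G_zero n hj g hg⟩
  · simp only [Equiv.symm_apply_apply]
    refine IsBasisWithConstLE.mono (isBasisWithConstLE_mkQ_of_norming _
      (f := fun i => (c i : 𝕜)⁻¹ • y i) (x := fun m => R (w m)) (M := ‖R‖) (β := β) (η := η)
      (D := Set.range (TopologicalSpace.denseSeq Z)) ?_ hbi ?_ hβ.le hη.le
      (TopologicalSpace.denseRange_denseSeq Z) ?_ ?_) ?_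
    · intro v
      have h1 : v ∈ commonKer (fun t : T => Φ (TreeBar.node t)) ↔ ∀ n, z n v = 0 := by
        rw [commonKer, Submodule.mem_iInf, ← τ.forall_congr_right]
        refine forall_congr' fun n => ?_
        rw [hΦn]
        rfl
      rw [h1]
      have h2 : (∀ i, ((c i : 𝕜)⁻¹ • y i) v = 0) ↔ ∀ i, y i v = 0 := forall_congr' fun i => by
        rw [smul_apply, smul_eq_mul, mul_eq_zero]
        simp [hc0 i]
      rw [h2]
      -- The `y i` are differences of the `z n`, and the `z n` are finite sums of the `y i`, so the
      -- two families have the same common kernel.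
      constructor
      · intro h i
        rw [hy_def, treeIncr]
        split_ifs
        · exact h 0
        · rw [sub_apply, h, h, sub_zero]
      · intro h n
        have h3 := hasSum_treeIncr hτ hp z v n
        rw [← hy_def] at h3
        simp only [h, ite_self] at h3
        exact h3.unique hasSum_zero
    · intro i
      refine (R.le_opNorm _).trans ?_
      rw [(hf i).norm_w, mul_one]
    · rintro _ ⟨i, rfl⟩
      filter_upwards [eventually_gt_atTop i] with j hj
      exact hscale j _ ((hf j).d_small i hj)
    · intro n g hg
      cases n with
      | zero =>
        refine ⟨0, by simp, ?_, fun _ _ => by simp; positivity⟩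
        have : g = 0 := by simpa using hg
        simp [this]
      | succ n =>
        rw [hIio] at hg
        have hg' : g ∈ Submodule.span 𝕜 (y '' Set.Iic n) := by
          refine Submodule.span_le.2 ?_ hg
          rintro _ ⟨i, hi, rfl⟩
          exact Submodule.smul_mem _ _ (Submodule.subset_span ⟨i, hi, rfl⟩)
        obtain ⟨u, hu, hgu⟩ := (hf n).S_norming g hg'
        exact ⟨u, (hf n).S_norm u hu, hgu, fun j hj => hscale j u ((hf j).S_small n hj u hu)⟩
    · rw [← hη2]
      exact mul_le_mul_of_nonneg_left (by linarith) (by positivity)
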